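/- Let $\phi=\frac{1+\sqrt5}2$. Let $P$ be a regular pentagon with a horizontal base, and let the double pentagon be the translation surface obtained from $P$ and $-P$ by gluing parallel sides by translations. Identify the set of directions (up to sign) with $\mathbb{RP}^1=\mathbb R\cup\{\infty\}$ by the coordinate $x=\sin 36^\circ\cot\theta$, where $\theta$ is the angle between the direction and the horizontal diagonal of $P$, and regard $\mathbb{RP}^1$ as the absolute of the hyperbolic plane. The ideal pentagon of generation $0$ has the vertices $1-\frac\phi2,\ \frac\phi2,\ \infty,\ -\frac\phi2,\ \frac\phi2-1$ (the directions of the diagonals of $P$). The pentagons of generation $k+1$ are the reflections of the pentagons of generation $k$ in their sides (for $k\ge 1$: in all sides but the one common with the pentagon of generation $k-1$). For a vertex $x$ of one of these pentagons, consider the linear trajectories in direction $x$ which avoid the cone point, and code each of them by the word of the labels of the consecutively crossed sides of the double pentagon (there are five glued pairs of sides). Up to shifts there are exactly two such words, both periodic (one for each of the two strips of parallel periodic trajectories). Their least periods $a\le A$ are the pair of Arabic periods of $x$. If $x=u\in\left[\frac\phi2-1,\,1-\frac\phi2\right]$, the trajectories are also coded by the intervals visited by the orbits of the exchange of the four intervals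 into which the points $$\tfrac12-u(\phi+1),\quad \tfrac\phi2-u,\quad \phi-\tfrac12-u(\phi+1)$$ divide $[0,\phi]$, with the permutation $\begin{pmatrix}\mathrm{I}&\mathrm{II}&\mathrm{III}&\mathrm{IV}\\ \mathrm{III}&\mathrm{I}&\mathrm{IV}&\mathrm{II}\end{pmatrix}$ (the first interval goes to the third place, and so on; only bi-infinite orbits avoiding the end points of the intervals are considered). Again there are, up to shifts, exactly two words, both periodic, and their least periods $a\le A$ are the pair of Roman periods of $x$. **Theorem.** Let $x,y$ be two vertices joined by a side of a pentagon of generation $k$, let the reflection in this side produce a pentagon of generation $k+1$, and let $z_1,z_2,z_3$ be the three additional vertices of the latter, so that $x,z_1,z_2,z_3,y$ are its consecutive vertices. Then $x$ and $y$ have pairs of Arabic periods, and if these are $(a,A)$ for $x$ and $(b,B)$ for $y$, then the pairs of Arabic periods of $z_1,z_2,z_3$ are, respectively, $$(b+A,\ a+A+B),\qquad (A+B,\ a+b+A+B),\qquad (a+B,\ b+A+B).$$ If $x,y\in\left[\frac\phi2-1,\,1-\frac\phi2\right]$, then the same holds for the pairs of Roman periods. -/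

import Mathlib

namespace DoublePentagon

noncomputable section

/-! ## Symbolic orbits and their periods -/

/-- Two bi-infinite words agree up to a shift. -/
def ShiftEquiv {S : Type} (w w' : ℤ → S) : Prop := ∃ m : ℤ, ∀ n, w' n = w (n + m)

/-- `p` is the (least positive) period of the bi-infinite word `w`. -/
def HasPeriod {S : Type} (w : ℤ → S) (p : ℕ) : Prop :=
  IsLeast {q : ℕ | 0 < q ∧ Function.Periodic w (q : ℤ)} p

/-- `W` is the set of all words of regular trajectories in some direction. The predicate says that,
up to shifts, `W` consists of exactly two periodic words (one for each of the two strips of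
parallel periodic trajectories), and that their periods are `a ≤ A`. -/
def IsPeriodPair {S : Type} (W : Set (ℤ → S)) (a A : ℕ) : Prop :=
  a ≤ A ∧ ∃ w ∈ W, ∃ w' ∈ W, ¬ ShiftEquiv w w' ∧
    (∀ v ∈ W, ShiftEquiv w v ∨ ShiftEquiv w' v) ∧ HasPeriod w a ∧ HasPeriod w' A

/-! ## Linear trajectories on the double pentagon -/

/-- The corners of the regular pentagon `P` with a horizontal base (and horizontal diagonal joining
`corner 1` and `corner 4`), in counterclockwise order, `corner 0` being the apex.
The double pentagon is obtained from `P` and `-P` by gluing the side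
`[corner k, corner (k + 1)]` of `P` to the parallel side `[-corner (k + 1), -corner k]` of `-P`
by the translation by `-glue k`. -/
def corner (k : ZMod 5) : ℂ :=
  Complex.I * Complex.exp (2 * Real.pi * Complex.I * (k.val : ℂ) / 5)

/-- Translation by `-glue k` takes the `k`th side of `P` to the `k`th side of `-P`. -/
def glue (k : ZMod 5) : ℂ := corner k + corner (k + 1)

/-- A regular (defined for all times and avoiding the cone point) linear trajectory in direction
`d` on the double pentagon: `w n` is the `n`th crossed side, and `z n` is the `n`th crossing point,
written in the coordinates of `P`. The numbering is such that at the crossings with even number the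
trajectory passes from `P` to `-P`, and at the crossings with odd number from `-P` to `P`. -/
structure IsTrajectory (d : ℂ) (w : ℤ → ZMod 5) (z : ℤ → ℂ) : Prop where
  mem_side : ∀ n, z n ∈ openSegment ℝ (corner (w n)) (corner (w n + 1))
  side_ne : ∀ n, w (n + 1) ≠ w n
  inside_neg : ∀ n, Even n →
    ∃ r : ℝ, 0 < r ∧ (z (n + 1) - glue (w (n + 1))) - (z n - glue (w n)) = r * d
  inside_pos : ∀ n, Odd n → ∃ r : ℝ, 0 < r ∧ z (n + 1) - z n = r * d

/-- The direction with affine coordinate `x ∈ ℝ ∪ {∞}`. The angle `θ` that it makes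
with the horizontal diagonal of `P` satisfies `x = sin 36° * cot θ`. -/
def direction : OnePoint ℝ → ℂ
  | none => 1
  | some x => (x : ℂ) + (Real.sin (Real.pi / 5) : ℂ) * Complex.I

/-- Words of crossed sides ("Arabic" symbolic orbits) of the regular trajectories in direction
`x`. -/
def arabicWords (x : OnePoint ℝ) : Set (ℤ → ZMod 5) :=
  {w | ∃ z, IsTrajectory (direction x) w z}

/-- `a ≤ A` are the two Arabic periods of the direction `x`. -/
def ArabicPeriods (x : OnePoint ℝ) (a A : ℕ) : Prop := IsPeriodPair (arabicWords x) a A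

/-! ## The interval exchange -/

open Real in
/-- The end points of the intervals I, II, III, IV in `[0, φ]`
(the horizontal diagonal of a pentagon with unit side). -/
def cut (u : ℝ) : Fin 5 → ℝ :=
  ![0, 1 / 2 - u * (goldenRatio + 1), goldenRatio / 2 - u,
    goldenRatio - 1 / 2 - u * (goldenRatio + 1), goldenRatio]

/-- Length of the `i`th interval. -/
def intervalLength (u : ℝ) (i : Fin 4) : ℝ := cut u i.succ - cut u i.castSucc

/-- The intervals I, II, III, IV go to the 3rd, 1st, 4th, 2nd place, respectively
(here the places are numbered from 0). -/
def place : Fin 4 → Fin 4 := ![2, 0, 3, 1]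

/-- The translation that the interval exchange applies to the `i`th interval. -/
def shift (u : ℝ) (i : Fin 4) : ℝ :=
  (∑ j with place j < place i, intervalLength u j) - ∑ j with j < i, intervalLength u j

/-- Words of visited intervals ("Roman" symbolic orbits) of the regular (bi-infinite and avoiding
the end points of the intervals) orbits of the interval exchange. -/
def intervalWords (u : ℝ) : Set (ℤ → Fin 4) :=
  {w | ∃ t : ℤ → ℝ, ∀ n, t n ∈ Set.Ioo (cut u (w n).castSucc) (cut u (w n).succ) ∧
    t (n + 1) = t n + shift u (w n)}

open Real in
/-- The principal (3rd) sector of directions, with its end points. -/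
def sector : Set (OnePoint ℝ) :=
  (fun x : ℝ => (x : OnePoint ℝ)) '' Set.Icc (goldenRatio / 2 - 1) (1 - goldenRatio / 2)

/-- `a ≤ A` are the two Roman periods of the direction `x` in the principal sector. -/
def RomanPeriods (x : OnePoint ℝ) (a A : ℕ) : Prop :=
  x ∈ sector ∧ ∃ u : ℝ, x = (u : OnePoint ℝ) ∧ IsPeriodPair (intervalWords u) a A

/-! ## Ideal pentagons -/

open Real in
/-- The clockwise rotation `x ↦ (2φx + 3 - φ) / (2φ - 4x)` by 72° of the hyperbolic plane. -/
def T : GL (Fin 2) ℝ :=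
  Matrix.GeneralLinearGroup.mkOfDetNeZero
    !![2 * goldenRatio, 3 - goldenRatio; -4, 2 * goldenRatio] (by
      rw [Matrix.det_fin_two_of]
      nlinarith [goldenRatio_sq])

open Real in
/-- The reflection `x ↦ 1 / (4φ⁴x)` in the geodesic `(φ/2 - 1, 1 - φ/2)`. -/
def R : GL (Fin 2) ℝ :=
  Matrix.GeneralLinearGroup.mkOfDetNeZero !![0, 1; 4 * goldenRatio ^ 4, 0] (by
      rw [Matrix.det_fin_two_of]
      have := goldenRatio_pos
      have : 0 < goldenRatio ^ 4 := by positivity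
      linarith)

open Real in
/-- The vertices, in cyclic order, of the ideal pentagon of generation 0. One has
`T • baseVertex j = baseVertex (j + 1)`. -/
def baseVertex : Fin 5 → OnePoint ℝ :=
  ![((1 - goldenRatio / 2 : ℝ) : OnePoint ℝ), ((goldenRatio / 2 : ℝ) : OnePoint ℝ), OnePoint.infty,
    ((-(goldenRatio / 2) : ℝ) : OnePoint ℝ), ((goldenRatio / 2 - 1 : ℝ) : OnePoint ℝ)]

/-- The vertices, in cyclic order, of the image under `g` of the pentagon of generation 0.
The sides of this image join `vertex g j` to `vertex g (j + 1)`. -/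
def vertex (g : GL (Fin 2) ℝ) (j : Fin 5) : OnePoint ℝ := g • baseVertex j

/-- The map that takes the pentagon of generation 0 to the reflection of its image under `g` in the
side joining `vertex g j` to `vertex g (j + 1)`: it is the composition of `g * T ^ (j + 1)` with
the reflection `(g * T ^ (j + 1)) * R * (g * T ^ (j + 1))⁻¹`. The common side of the two pentagons
is the side of the new one that joins its vertices 4 and 0
(`vertex (across g j) 4 = vertex g j` and `vertex (across g j) 0 = vertex g (j + 1)`). -/
def across (g : GL (Fin 2) ℝ) (j : Fin 5) : GL (Fin 2) ℝ := g * T ^ (j.val + 1) * R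

/-- The `j`th side of a pentagon of generation `k` is outer if it separates this pentagon from a
pentagon of generation `k + 1`: for `k = 0` all sides are outer, and for `k > 0` all but the side
common with the pentagon of generation `k - 1`. -/
def IsOuterSide (k : ℕ) (j : Fin 5) : Prop := k = 0 ∨ j ≠ 4

/-- The image under `g` of the pentagon of generation 0 is a pentagon of generation `k`. -/
inductive IsPentagon : ℕ → GL (Fin 2) ℝ → Prop
  | zero : IsPentagon 0 1
  | succ {k : ℕ} {g : GL (Fin 2) ℝ} {j : Fin 5} :
      IsPentagon k g → IsOuterSide k j → IsPentagon (k + 1) (across g j)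

end

end DoublePentagon

/-! In the directions of the principal sector, a regular trajectory keeps returning to the
horizontal diagonal of `P`. The first return map is the exchange of four intervals, and the visited
interval determines the two sides crossed before the return (`codes_arabic`). The sector is
parametrized projectively by pairs `(a, b)` of nonnegative numbers, not both zero; after rescaling,
the exchange for `coord (a, b)` has the lengths `φa, b, a, φb` (`intervalWords_coord`).

Exchanges of this kind are renormalizable. Those for `(a + φb, b)` and `(φa + φb, a + φb)` induce
the one for `(a, b)` on a subinterval, so their words arise from its words by substituting return
words (`codes_parabolic`, `codes_hyperbolic`); reversing the interval swaps `a` and `b`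
(`codes_flip`). For the pairs `(1, 0)` and `(0, 1)` only two intervals have positive length and
every point is fixed, which gives two constant words. Hence every pair obtained from these two has
exactly two words up to shifts. Their letter counts are linear in the four natural coefficients of
the pair over `1, φ`, and the counts of the long word are those of the short word for the pair
multiplied by `φ`. The coefficients stay without a common divisor, so that the counts give least
periods (`HasCounts.hasPeriod`).

On the hyperbolic side, passing from the side of a pentagon common with the previous generation to
another side acts on pairs by one of four linear maps `move j` (`R_mul_T_pow_smul_coord`). Up to a
rotation fixed by the initial side, a side of any generation is therefore the image of the base side
under a composition of these maps (`exists_walk`). By linearity, if `X` and `Y` are the pairs of the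
ends of a side, then the new vertices have the pairs `φX + Y`, `φ(X + Y)`, `X + φY`
(`vertex_across_eq`). Since `short` and `long` are additive and multiplication by `φ` takes `(short,
long)` to `(long, short + long)`, the recurrences follow (`recurrence`).

Arabic periods are twice the Roman ones and are invariant under `T` (`ArabicPeriods.T_smul`). Roman
periods make sense only in the sector, where the rotation has to be trivial
(`mod_five_eq_zero_of_mem_sector`). -/

namespace DoublePentagon

/-! ## Bi-infinite words: windows, codings and letter counts -/

/-- A relation that is total in both directions has a bi-infinite path through any point. -/
theorem exists_int_path {X : Type} {r : X → X → Prop} (x : X)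
    (hf : ∀ x, ∃ y, r x y) (hb : ∀ y, ∃ x, r x y) :
    ∃ s : ℤ → X, s 0 = x ∧ ∀ n, r (s n) (s (n + 1)) := by
  choose f hf using hf
  choose g hg using hb
  refine ⟨fun n => if 0 ≤ n then f^[n.toNat] x else g^[(-n).toNat] x, by simp, fun n => ?_⟩
  rcases lt_trichotomy n (-1) with h | rfl | h
  · have e : (-n).toNat = (-(n + 1)).toNat + 1 := by omega
    beta_reduce
    rw [if_neg (by omega), if_neg (by omega), e, Function.iterate_succ_apply']
    exact hg _
  · simpa using hg x
  · have e : (n + 1).toNat = n.toNat + 1 := by omega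
    beta_reduce
    rw [if_pos (by omega), if_pos (by omega), e, Function.iterate_succ_apply']
    exact hf _

variable {S S' : Type}

/-- The subword of length `k` of `w` that starts at the position `m`. -/
def window (w : ℤ → S) : ℤ → ℕ → List S
  | _, 0 => []
  | m, k + 1 => w m :: window w (m + 1) k

theorem window_succ (w : ℤ → S) (m : ℤ) (k : ℕ) :
    window w m (k + 1) = w m :: window w (m + 1) k := rfl

@[simp] theorem window_zero (w : ℤ → S) (m : ℤ) : window w m 0 = [] := rfl

@[simp] theorem length_window (w : ℤ → S) (m : ℤ) (k : ℕ) : (window w m k).length = k := by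
  induction k generalizing m with
  | zero => rfl
  | succ k ih => simp [window_succ, ih]

theorem window_add (w : ℤ → S) (m : ℤ) (k l : ℕ) :
    window w m (k + l) = window w m k ++ window w (m + k) l := by
  induction k generalizing m with
  | zero => simp
  | succ k ih =>
    rw [show k + 1 + l = (k + l) + 1 by omega, window_succ, window_succ, ih]
    simp [add_left_comm, add_comm]

theorem getElem_window (w : ℤ → S) (m : ℤ) (k j : ℕ) (h : j < (window w m k).length) :
    (window w m k)[j] = w (m + j) := by
  induction k generalizing m j with
  | zero => simp at h
  | succ k ih =>
    cases j with
    | zero => simp [window_succ]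
    | succ j =>
      simp only [window_succ, List.getElem_cons_succ, ih]
      congr 1
      push_cast
      ring

theorem window_congr {w v : ℤ → S} {m n : ℤ} {k : ℕ}
    (h : ∀ j : ℕ, j < k → w (m + j) = v (n + j)) : window w m k = window v n k := by
  refine List.ext_getElem (by simp) fun j h₁ h₂ => ?_
  rw [getElem_window, getElem_window]
  exact h j (by simpa using h₁)

theorem eq_of_window_eq {w v : ℤ → S} {m n : ℤ} {k : ℕ} (h : window w m k = window v n k)
    {j : ℕ} (hj : j < k) : w (m + j) = v (n + j) := by
  rw [← getElem_window w m k j (by simpa), ← getElem_window v n k j (by simpa)]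
  simp [h]

/-- The word `w` is obtained from `w'` by the substitution `σ`, up to a shift. -/
def IsCoding (σ : S' → List S) (w' : ℤ → S') (w : ℤ → S) : Prop :=
  ∃ s : ℤ → ℤ, ∀ n, s (n + 1) = s n + (σ (w' n)).length ∧
    window w (s n) (σ (w' n)).length = σ (w' n)

/-- The words of `W` are, up to shifts, those obtained from the words of `W'` by the
substitution `σ`. -/
def Codes (σ : S' → List S) (W' : Set (ℤ → S')) (W : Set (ℤ → S)) : Prop :=
  (∀ w' ∈ W', ∃ w ∈ W, IsCoding σ w' w) ∧ ∀ w ∈ W, ∃ w' ∈ W', IsCoding σ w' w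

theorem exists_mem_block {s : ℤ → ℤ} (hs : ∀ n, s n < s (n + 1)) (k : ℤ) :
    ∃ n, s n ≤ k ∧ k < s (n + 1) := by
  induction k using Int.inductionOn' (b := s 0) with
  | zero => exact ⟨0, le_rfl, hs 0⟩
  | succ k _ ih =>
    obtain ⟨n, h₁, h₂⟩ := ih
    by_cases h : k + 1 < s (n + 1)
    · exact ⟨n, by omega, h⟩
    · exact ⟨n + 1, by omega, by have := hs (n + 1); omega⟩
  | pred k _ ih =>
    obtain ⟨n, h₁, h₂⟩ := ih
    by_cases h : s n ≤ k - 1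
    · exact ⟨n, h, by omega⟩
    · refine ⟨n - 1, ?_, ?_⟩
      · have := hs (n - 1)
        rw [sub_add_cancel] at this
        omega
      · rw [sub_add_cancel]
        omega

/-- Partial sums of positive lengths. -/
theorem exists_partial_sums (l : ℤ → ℕ) : ∃ s : ℤ → ℤ, ∀ n, s (n + 1) = s n + l n := by
  obtain ⟨s, -, hs⟩ := exists_int_path (X := ℤ × ℤ)
    (r := fun x y => y.1 = x.1 + 1 ∧ y.2 = x.2 + l x.1) (0, 0)
    (fun x => ⟨(x.1 + 1, x.2 + l x.1), rfl, rfl⟩)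
    (fun y => ⟨(y.1 - 1, y.2 - l (y.1 - 1)), by simp, by simp⟩)
  have h₁ : ∀ n, (s n).1 = (s 0).1 + n := by
    intro n
    induction n using Int.induction_on with
    | zero => simp
    | succ n ih => rw [(hs _).1, ih]; ring
    | pred n ih =>
      have := (hs (-n - 1)).1
      rw [sub_add_cancel, ih] at this
      linarith
  refine ⟨fun n => (s (n - (s 0).1)).2, fun n => ?_⟩
  have := (hs (n - (s 0).1)).2
  rw [h₁ (n - (s 0).1)] at this
  beta_reduce
  rw [show n + 1 - (s 0).1 = n - (s 0).1 + 1 by ring, this]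
  congr 3
  ring

/-- Shift equivalent words have shift equivalent codings. -/
theorem IsCoding.shift {σ : S' → List S} (hσ : ∀ i, σ i ≠ []) {w' v' : ℤ → S'} {w v : ℤ → S}
    {s r : ℤ → ℤ}
    (hw : ∀ n, s (n + 1) = s n + (σ (w' n)).length ∧
      window w (s n) (σ (w' n)).length = σ (w' n))
    (hv : ∀ n, r (n + 1) = r n + (σ (v' n)).length ∧
      window v (r n) (σ (v' n)).length = σ (v' n))
    {m : ℤ} (h : ∀ n, v' n = w' (n + m)) (k : ℤ) : v k = w (k + (s m - r 0)) := by
  have hr : ∀ n, r n < r (n + 1) := by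
    intro n
    have := List.length_pos_of_ne_nil (hσ (v' n))
    rw [(hv n).1]
    omega
  -- Corresponding blocks of the two codings have equal lengths, so the offset between their
  -- beginnings is constant.
  have key : ∀ n, s (n + m) - r n = s m - r 0 := by
    intro n
    induction n using Int.induction_on with
    | zero => simp
    | succ n ih =>
      rw [← ih, (hv _).1, show (n + 1 + m : ℤ) = (n + m) + 1 by ring, (hw _).1, h]
      ring
    | pred n ih =>
      have h₁ := (hv (-n - 1)).1
      have h₂ := (hw (-n - 1 + m)).1
      rw [sub_add_cancel] at h₁
      rw [show (-n - 1 + m + 1 : ℤ) = -n + m by ring] at h₂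
      rw [h] at h₁
      rw [← ih, h₁, h₂]
      ring
  obtain ⟨n, h₁, h₂⟩ := exists_mem_block hr k
  obtain ⟨j, rfl⟩ : ∃ j : ℕ, k = r n + j := ⟨(k - r n).toNat, by omega⟩
  rw [(hv n).1] at h₂
  have := eq_of_window_eq (w := v) (v := w) (m := r n) (n := s (n + m))
    (k := (σ (v' n)).length) (by rw [(hv n).2, h n, (hw (n + m)).2]) (j := j) (by omega)
  rw [this, show s m - r 0 = s (n + m) - r n from (key n).symm]
  congr 1
  ring

theorem ShiftEquiv.coding {σ : S' → List S} (hσ : ∀ i, σ i ≠ []) {w' v' : ℤ → S'}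
    {w v : ℤ → S} (h : ShiftEquiv w' v') (hw : IsCoding σ w' w) (hv : IsCoding σ v' v) :
    ShiftEquiv w v := by
  obtain ⟨s, hs⟩ := hw
  obtain ⟨r, hr⟩ := hv
  obtain ⟨m, hm⟩ := h
  exact ⟨_, IsCoding.shift hσ hs hr hm⟩

theorem HasPeriod.unique {w : ℤ → S} {p q : ℕ} (h : HasPeriod w p) (h' : HasPeriod w q) :
    p = q := IsLeast.unique h h'

theorem ShiftEquiv.symm {w v : ℤ → S} (h : ShiftEquiv w v) : ShiftEquiv v w := by
  obtain ⟨m, hm⟩ := h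
  exact ⟨-m, fun n => by rw [hm]; simp⟩

theorem ShiftEquiv.trans {w v u : ℤ → S} (h : ShiftEquiv w v) (h' : ShiftEquiv v u) :
    ShiftEquiv w u := by
  obtain ⟨m, hm⟩ := h
  obtain ⟨k, hk⟩ := h'
  exact ⟨k + m, fun n => by rw [hk, hm, add_assoc]⟩

theorem ShiftEquiv.periodic {w v : ℤ → S} (h : ShiftEquiv w v) {c : ℤ}
    (hw : Function.Periodic w c) : Function.Periodic v c := by
  obtain ⟨m, hm⟩ := h
  intro n
  rw [hm, hm, show n + c + m = n + m + c by ring, hw]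

theorem ShiftEquiv.periodic_iff {w v : ℤ → S} (h : ShiftEquiv w v) {c : ℤ} :
    Function.Periodic w c ↔ Function.Periodic v c := ⟨h.periodic, h.symm.periodic⟩

theorem ShiftEquiv.hasPeriod {w v : ℤ → S} (h : ShiftEquiv w v) {p : ℕ} (hw : HasPeriod w p) :
    HasPeriod v p := by
  simpa only [HasPeriod, h.periodic_iff] using hw

/-- The two pairs of representatives match either in order or crosswise; in the crossed case the
inequalities `a ≤ A` and `b ≤ B` force all periods to coincide. This identifies periods given by
hypothesis with computed ones. -/
theorem IsPeriodPair.unique {W : Set (ℤ → S)} {a A b B : ℕ} (h : IsPeriodPair W a A)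
    (h' : IsPeriodPair W b B) : a = b ∧ A = B := by
  obtain ⟨hle, w, hw, v, hv, hne, hall, hpw, hpv⟩ := h
  obtain ⟨hle', w', hw', v', hv', hne', hall', hpw', hpv'⟩ := h'
  rcases hall w' hw' with h₁ | h₁ <;> rcases hall v' hv' with h₂ | h₂
  · exact (hne' (h₁.symm.trans h₂)).elim
  · exact ⟨(h₁.hasPeriod hpw).unique hpw', (h₂.hasPeriod hpv).unique hpv'⟩
  · have := (h₁.hasPeriod hpv).unique hpw'
    have := (h₂.hasPeriod hpw).unique hpv'
    omega
  · exact (hne' (h₁.symm.trans h₂)).elim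

/-- Moving the window by one drops a letter on the left and adds the same letter on the right. -/
theorem window_perm_of_periodic {w : ℤ → S} {p : ℕ} (h : Function.Periodic w (p : ℤ)) (m n : ℤ) :
    (window w m p).Perm (window w n p) := by
  have step : ∀ m, (window w m p).Perm (window w (m + 1) p) := by
    intro m
    have h₁ := window_add w m 1 p
    have h₂ := window_add w m p 1
    have h₃ : window w (m + p) 1 = window w m 1 := by simp [window_succ, h m]
    rw [add_comm, h₂, h₃] at h₁
    have h₄ : (window w m 1 ++ window w m p).Perm (window w m 1 ++ window w (m + 1) p) := by
      have := List.perm_append_comm (l₁ := window w m 1) (l₂ := window w m p)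
      rw [h₁] at this
      simpa using this
    exact (List.perm_append_left_iff _).1 h₄
  have : ∀ n, (window w 0 p).Perm (window w n p) := by
    intro n
    induction n using Int.induction_on with
    | zero => exact .refl _
    | succ n ih => exact ih.trans (step _)
    | pred n ih =>
      have := step (-n - 1)
      rw [sub_add_cancel] at this
      exact ih.trans this.symm
  exact (this m).symm.trans (this n)

/-! ### Letter counts over a period -/

variable [DecidableEq S] [DecidableEq S']

/-- `w` is periodic, and over some period (not necessarily the least one) each letter `i` occurs
`c i` times. -/
def HasCounts (w : ℤ → S) (c : S → ℕ) : Prop :=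
  ∃ (p : ℕ) (m : ℤ), Function.Periodic w (p : ℤ) ∧ ∀ i, (window w m p).count i = c i

theorem sum_count [Fintype S] (l : List S) : ∑ i, l.count i = l.length := by
  induction l with
  | nil => simp
  | cons a l ih => simp [List.count_cons, Finset.sum_add_distrib, ih]

/-- Concatenating the blocks of one period of `w'` gives a period of `w`, so the counts are
transformed by the incidence matrix of `σ`. Leastness of the period is not tracked, as it need not
survive a substitution. -/
theorem HasCounts.coding {σ : S' → List S} [Fintype S'] (hσ : ∀ i, σ i ≠ []) {w' : ℤ → S'}
    {w : ℤ → S} {c : S' → ℕ} (h : HasCounts w' c) (hw : IsCoding σ w' w) :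
    HasCounts w fun i => ∑ j, c j * (σ j).count i := by
  obtain ⟨p, m, hp, hc⟩ := h
  obtain ⟨s, hs⟩ := hw
  have key : ∀ k : ℕ, ∃ q : ℕ, s (m + k) = s m + q ∧
      ∀ i, (window w (s m) q).count i = ∑ j, (window w' m k).count j * (σ j).count i := by
    intro k
    induction k with
    | zero => exact ⟨0, by simp⟩
    | succ k ih =>
      obtain ⟨q, hq, hqc⟩ := ih
      refine ⟨q + (σ (w' (m + k))).length, ?_, fun i => ?_⟩
      · push_cast
        rw [← add_assoc, (hs _).1, hq, add_assoc]
      · rw [window_add, List.count_append, hqc, ← hq, (hs _).2, window_add]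
        simp [window_succ, List.count_cons, add_mul, Finset.sum_add_distrib]
  obtain ⟨q, hq, hqc⟩ := key p
  refine ⟨q, s m, fun k => ?_, fun i => by simp [hqc, hc]⟩
  have hm := IsCoding.shift hσ hs hs (m := p) (fun n => (hp n).symm)
  -- Here the coding is compared with itself `p` blocks later: block `m` starts at `s m` and block
  -- `m + p` at `s m + q`, so `q` is a period.
  have hm' := IsCoding.shift (m := m + p) (r := fun n => s (n + m)) hσ hs
    (fun n => ⟨by rw [← (hs _).1]; congr 1; ring, (hs (n + m)).2⟩)
    (v' := fun n => w' (n + m)) (fun n => by rw [← add_assoc, hp]) k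
  rw [hm']
  congr 1
  simp only [zero_add, hq]
  ring

/-- Up to shifts, `W` consists of two (possibly equal) periodic words with the letter counts
`c` and `C`. -/
def TwoWords (W : Set (ℤ → S)) (c C : S → ℕ) : Prop :=
  ∃ w ∈ W, ∃ w' ∈ W, (∀ v ∈ W, ShiftEquiv w v ∨ ShiftEquiv w' v) ∧
    HasCounts w c ∧ HasCounts w' C

theorem TwoWords.codes [Fintype S'] {σ : S' → List S} (hσ : ∀ i, σ i ≠ []) {W' : Set (ℤ → S')}
    {W : Set (ℤ → S)} (hW : Codes σ W' W) {c C : S' → ℕ} (h : TwoWords W' c C) :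
    TwoWords W (fun i => ∑ j, c j * (σ j).count i) (fun i => ∑ j, C j * (σ j).count i) := by
  obtain ⟨u, hu, v, hv, huv, hc, hC⟩ := h
  obtain ⟨u₁, hu₁, hu'⟩ := hW.1 u hu
  obtain ⟨v₁, hv₁, hv'⟩ := hW.1 v hv
  refine ⟨u₁, hu₁, v₁, hv₁, fun x hx => ?_, hc.coding hσ hu', hC.coding hσ hv'⟩
  obtain ⟨x', hx', hxx⟩ := hW.2 x hx
  exact (huv x' hx').imp (fun h => h.coding hσ hu' hxx) (fun h => h.coding hσ hv' hxx)

/-- If `q` is another period, then so is `g = gcd p q`; the window of length `p` consists of `p / g`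
windows with equal counts, so `p / g` divides every `c i` and must be `1`. -/
theorem HasCounts.hasPeriod [Fintype S] {w : ℤ → S} {c : S → ℕ} (h : HasCounts w c)
    (hc : ∀ d, (∀ i, d ∣ c i) → d = 1) : HasPeriod w (∑ i, c i) := by
  obtain ⟨p, m, hp, hpc⟩ := h
  obtain rfl : ∑ i, c i = p := by simp [← hpc, sum_count]
  set p := ∑ i, c i with hpdef
  have hp0 : 0 < p := by
    rcases Nat.eq_zero_or_pos p with h | h
    -- An empty period would make all counts zero, with the common divisor `2`.
    · have : ∀ i, c i = 0 := by simpa [h] using hpdef.symm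
      have := hc 2 (fun i => by simp [this])
      omega
    · exact h
  refine ⟨⟨hp0, hp⟩, fun q ⟨hq0, hq⟩ => ?_⟩
  set g := Nat.gcd p q with hg
  have hgper : Function.Periodic w (g : ℤ) := by
    rw [hg, Nat.gcd_eq_gcd_ab]
    have h₁ : Function.Periodic w ((p : ℤ) * p.gcdA q) := by
      rw [mul_comm]; exact hp.int_mul _
    have h₂ : Function.Periodic w ((q : ℤ) * p.gcdB q) := by
      rw [mul_comm]; exact hq.int_mul _
    exact h₁.add_period h₂
  obtain ⟨r, hr⟩ : g ∣ p := Nat.gcd_dvd_left p q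
  have hcount : ∀ k : ℕ, ∀ i, (window w m (g * k)).count i = k * (window w m g).count i := by
    intro k i
    induction k with
    | zero => simp
    | succ k ih =>
      rw [mul_add_one, window_add, List.count_append, ih,
        (window_perm_of_periodic hgper (m + (g * k : ℕ)) m).count_eq]
      ring
  have hr1 : r = 1 := hc r fun i => ⟨_, by rw [← hpc, hr, hcount]⟩
  rw [hr1, mul_one] at hr
  rw [hr]
  exact Nat.le_of_dvd hq0 (Nat.gcd_dvd_right p q)

/-- The counts over a least period are invariant under shifts, so different counts make the two
words inequivalent. -/
theorem TwoWords.isPeriodPair [Fintype S] {W : Set (ℤ → S)} {c C : S → ℕ} (h : TwoWords W c C)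
    (hc : ∀ d, (∀ i, d ∣ c i) → d = 1) (hC : ∀ d, (∀ i, d ∣ C i) → d = 1)
    (hle : ∑ i, c i ≤ ∑ i, C i) (hne : c ≠ C) :
    IsPeriodPair W (∑ i, c i) (∑ i, C i) := by
  obtain ⟨w, hw, v, hv, hall, hcw, hCv⟩ := h
  have hw' := hcw.hasPeriod hc
  have hv' := hCv.hasPeriod hC
  refine ⟨hle, w, hw, v, hv, fun hs => hne ?_, hall, hw', hv'⟩
  have hpq := (hs.hasPeriod hw').unique hv'
  obtain ⟨p, m, hp, hpc⟩ := hcw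
  obtain ⟨q, n, hq, hqc⟩ := hCv
  have hpe : ∑ i, c i = p := by simp [← hpc, sum_count]
  have hqe : ∑ i, C i = q := by simp [← hqc, sum_count]
  rw [hpe, hqe] at hpq
  subst hpq
  obtain ⟨k, hk⟩ := hs
  funext i
  rw [← hpc, ← hqc, window_congr (w := v) (v := w) (n := n + k)
    (fun j _ => by rw [hk]; congr 1; ring)]
  exact (window_perm_of_periodic hp _ _).count_eq i

end DoublePentagon

namespace DoublePentagon

/-! ## Orbits of piecewise translations and their induced maps -/

section Orbits

variable {S S' : Type}

/-- `t` is an orbit with the symbolic word `w` of the map that translates each interval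
`(lo i, hi i)` by `sh i`. -/
def IsOrbit (lo hi sh : S → ℝ) (w : ℤ → S) (t : ℤ → ℝ) : Prop :=
  ∀ n, t n ∈ Set.Ioo (lo (w n)) (hi (w n)) ∧ t (n + 1) = t n + sh (w n)

/-- The symbolic words of all bi-infinite orbits of a piecewise translation. -/
def orbitWords (lo hi sh : S → ℝ) : Set (ℤ → S) := {w | ∃ t, IsOrbit lo hi sh w t}

/-- The orbit of `x` visits the intervals listed in `l`, and then arrives at `y`. -/
def Follows (lo hi sh : S → ℝ) : List S → ℝ → ℝ → Prop
  | [], x, y => x = y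
  | i :: l, x, y => x ∈ Set.Ioo (lo i) (hi i) ∧ Follows lo hi sh l (x + sh i) y

variable {lo hi sh : S → ℝ} {lo' hi' sh' : S' → ℝ}

theorem Follows.mem {l : List S} {x y : ℝ} (h : Follows lo hi sh l x y) {j : ℕ}
    (hj : j < l.length) : x + ((l.take j).map sh).sum ∈ Set.Ioo (lo l[j]) (hi l[j]) := by
  induction l generalizing x j with
  | nil => simp at hj
  | cons i l ih =>
    cases j with
    | zero => simpa using h.1
    | succ j => simpa [add_assoc] using ih h.2 (by simpa using hj)

theorem Follows.eq {l : List S} {x y : ℝ} (h : Follows lo hi sh l x y) :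
    x + (l.map sh).sum = y := by
  induction l generalizing x with
  | nil => simpa [Follows] using h
  | cons i l ih => simpa [add_assoc] using ih h.2

theorem IsOrbit.apply_add {w : ℤ → S} {t : ℤ → ℝ} (h : IsOrbit lo hi sh w t) (n : ℤ) (k : ℕ) :
    t (n + k) = t n + ((window w n k).map sh).sum := by
  induction k generalizing n with
  | zero => simp
  | succ k ih =>
    have := ih (n + 1)
    rw [(h n).2] at this
    simp only [window_succ, List.map_cons, List.sum_cons]
    rw [← add_assoc, ← this]
    congr 1
    push_cast
    ring

/-- If the orbits of one piecewise translation are the orbits of the map that another one induces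
on a subset `P`, and the subset shifted by `-c` is divided into intervals with the return words
`σ i`, then `σ` describes the relation of the symbolic words. -/
theorem codes_orbitWords {σ : S' → List S} (hσ : ∀ i, σ i ≠ []) (c : ℝ) (P : ℝ → Prop)
    (hfollow : ∀ i, ∀ x ∈ Set.Ioo (lo' i) (hi' i),
      Follows lo hi sh (σ i) (x + c) (x + sh' i + c) ∧ P (x + c) ∧ P (x + sh' i + c))
    (hvisit : ∀ w t, IsOrbit lo hi sh w t → ∃ n, P (t n))
    (hnext : ∀ w t, IsOrbit lo hi sh w t → ∀ n, P (t n) →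
      ∃ i, window w n (σ i).length = σ i ∧ t n - c ∈ Set.Ioo (lo' i) (hi' i))
    (hprev : ∀ w t, IsOrbit lo hi sh w t → ∀ n, P (t n) →
      ∃ i m, m + (σ i).length = n ∧ window w m (σ i).length = σ i ∧
        t m - c ∈ Set.Ioo (lo' i) (hi' i)) :
    Codes σ (orbitWords lo' hi' sh') (orbitWords lo hi sh) := by
  refine ⟨fun w' ⟨t', h'⟩ => ?_, fun w ⟨t, h⟩ => ?_⟩
  · obtain ⟨s, hs⟩ := exists_partial_sums fun n => (σ (w' n)).length
    have hpos : ∀ n, s n < s (n + 1) := fun n => by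
      have := List.length_pos_of_ne_nil (hσ (w' n))
      rw [hs]
      omega
    have hmono : StrictMono s := strictMono_int_of_lt_succ hpos
    -- `N k` is the index of the block that contains the position `k`; letters and points of the new
    -- orbit are read off inside this block.
    choose N hN using exists_mem_block hpos
    have hNe : ∀ n (j : ℕ), j < (σ (w' n)).length → N (s n + j) = n := by
      intro n j hj
      have h₁ := hN (s n + j)
      have h₂ := hs n
      have h₃ : s (N (s n + j)) < s (n + 1) := by omega
      have h₄ : s n < s (N (s n + j) + 1) := by omega
      have := hmono.lt_iff_lt.1 h₃
      have := hmono.lt_iff_lt.1 h₄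
      omega
    have hlt : ∀ k, (k - s (N k)).toNat < (σ (w' (N k))).length := by
      intro k
      have h₁ := hN k
      have h₂ := hs (N k)
      omega
    set w : ℤ → S := fun k => (σ (w' (N k)))[(k - s (N k)).toNat]'(hlt k) with hw
    set t : ℤ → ℝ := fun k =>
      t' (N k) + c + (((σ (w' (N k))).take (k - s (N k)).toNat).map sh).sum with ht
    have hwj : ∀ n (j : ℕ) (hj : j < (σ (w' n)).length), w (s n + j) = (σ (w' n))[j] := by
      intro n j hj
      simp [hw, hNe n j hj]
    have htj : ∀ n (j : ℕ), j < (σ (w' n)).length →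
        t (s n + j) = t' n + c + (((σ (w' n)).take j).map sh).sum := by
      intro n j hj
      simp [ht, hNe n j hj]
    refine ⟨w, ⟨t, fun k => ?_⟩, s, fun n => ⟨hs n, ?_⟩⟩
    · have hf := (hfollow (w' (N k)) (t' (N k)) (h' (N k)).1).1
      refine ⟨hf.mem (hlt k), ?_⟩
      set n := N k with hn
      obtain ⟨j, hj⟩ : ∃ j : ℕ, k = s n + j :=
        ⟨(k - s n).toNat, by have := hN k; rw [← hn] at this; omega⟩
      have hjl : j < (σ (w' n)).length := by
        have := hlt k
        rw [← hn, hj] at this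
        simpa using this
      have e₁ : ((σ (w' n)).take (j + 1)).map sh =
          ((σ (w' n)).take j).map sh ++ [sh (σ (w' n))[j]] := by
        rw [List.take_succ_eq_append_getElem hjl, List.map_append, List.map_singleton]
      rcases lt_or_eq_of_le (Nat.succ_le_of_lt hjl) with hjl' | hjl'
      · rw [hj, hwj n j hjl, htj n j hjl, show s n + j + 1 = s n + (j + 1 : ℕ) by push_cast; ring,
          htj n _ hjl', e₁]
        simp [add_assoc]
      · have e₂ : s n + j + 1 = s (n + 1) + (0 : ℕ) := by
          rw [hs, ← hjl']
          push_cast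
          ring
        rw [hj, e₂, hwj n j hjl, htj n j hjl,
          htj (n + 1) 0 (List.length_pos_of_ne_nil (hσ _)), (h' n).2, ← hf.eq]
        have e₃ : (σ (w' n)).take (j + 1) = σ (w' n) := by
          rw [List.take_of_length_le]; omega
        rw [e₃] at e₁
        rw [e₁]
        simp [add_assoc]
    · refine List.ext_getElem (by simp) fun j h₁ h₂ => ?_
      rw [getElem_window, hwj n j h₂]
  · have hP : ∀ i m, window w m (σ i).length = σ i → t m - c ∈ Set.Ioo (lo' i) (hi' i) →
        t (m + (σ i).length) - c = t m - c + sh' i ∧ P (t m) ∧ P (t (m + (σ i).length)) := by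
      intro i m hw ht
      obtain ⟨hf, h₁, h₂⟩ := hfollow i _ ht
      have e := hf.eq
      have e' := h.apply_add m (σ i).length
      rw [hw] at e'
      have e'' : t (m + (σ i).length) = t m - c + sh' i + c := by
        rw [e', ← e]
        ring
      refine ⟨by rw [e'']; ring, by simpa using h₁, by rw [e'']; exact h₂⟩
    -- The visits to `P` are linked into a bi-infinite chain: `hnext` supplies successors and
    -- `hprev` predecessors, starting from the one visit given by `hvisit`.
    obtain ⟨n₀, h₀⟩ := hvisit w t h
    obtain ⟨s, -, hs⟩ := exists_int_path (X := {n // P (t n)})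
      (r := fun m n => ∃ i, (m : ℤ) + (σ i).length = n ∧
        window w m (σ i).length = σ i ∧ t m - c ∈ Set.Ioo (lo' i) (hi' i)) ⟨n₀, h₀⟩
      (fun m => by
        obtain ⟨i, h₁, h₂⟩ := hnext w t h m m.2
        exact ⟨⟨_, (hP i m h₁ h₂).2.2⟩, i, rfl, h₁, h₂⟩)
      (fun n => by
        obtain ⟨i, m, h₁, h₂, h₃⟩ := hprev w t h n n.2
        exact ⟨⟨m, (hP i m h₂ h₃).2.1⟩, i, h₁, h₂, h₃⟩)
    choose w' hw' using hs
    refine ⟨w', ⟨fun n => t (s n) - c, fun n => ⟨(hw' n).2.2, ?_⟩⟩, fun n => s n, fun n =>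
      ⟨(hw' n).1.symm, (hw' n).2.1⟩⟩
    beta_reduce
    rw [← (hw' n).1]
    exact (hP _ _ (hw' n).2.1 (hw' n).2.2).1

end Orbits

/-! ## Exchanges of four intervals with the permutation (II, IV, I, III) -/

/-- The left end points of adjacent intervals I, II, III, IV with the lengths `p`, `b`, `a`, `q`. -/
def leftEnd (p b a : ℝ) : Fin 4 → ℝ := ![0, p, p + b, p + b + a]

/-- The right end points of adjacent intervals I, II, III, IV with the lengths `p`, `b`, `a`,
`q`. -/
def rightEnd (p b a q : ℝ) : Fin 4 → ℝ := ![p, p + b, p + b + a, p + b + a + q]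

/-- The translations of the exchange that places the intervals in the order II, IV, I, III. -/
def translation (p b a q : ℝ) : Fin 4 → ℝ := ![b + q, -p, q, -(p + a)]

/-- The symbolic words of the exchange of intervals I, II, III, IV with the lengths `p`, `b`, `a`,
`q` that places them in the order II, IV, I, III. -/
def exchangeWords (p b a q : ℝ) : Set (ℤ → Fin 4) :=
  orbitWords (leftEnd p b a) (rightEnd p b a q) (translation p b a q)

theorem IsOrbit.cases {p b a q : ℝ} {w : ℤ → Fin 4} {t : ℤ → ℝ}
    (h : IsOrbit (leftEnd p b a) (rightEnd p b a q) (translation p b a q) w t) (n : ℤ) :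
    (w n = 0 ∧ 0 < t n ∧ t n < p ∧ t (n + 1) = t n + (b + q)) ∨
    (w n = 1 ∧ p < t n ∧ t n < p + b ∧ t (n + 1) = t n - p) ∨
    (w n = 2 ∧ p + b < t n ∧ t n < p + b + a ∧ t (n + 1) = t n + q) ∨
    (w n = 3 ∧ p + b + a < t n ∧ t n < p + b + a + q ∧ t (n + 1) = t n - (p + a)) := by
  have := h n
  generalize w n = i at this ⊢
  fin_cases i
  all_goals
    simp [leftEnd, rightEnd, translation] at this ⊢
    try (obtain ⟨⟨h₁, h₂⟩, h₃⟩ := this; refine ⟨h₁, h₂, ?_⟩; linarith)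

/-- The substitution for the parabolic renormalization. -/
def parabolicSubst : Fin 4 → List (Fin 4) := ![[0], [1, 0], [2], [2, 3, 0]]

/-- The larger exchange is induced on the complement of the images of II and IV on the left (length
`b + q`) and of IV itself on the right (length `q`). Points of IV land in the left piece, and the
left piece, being part of I, is translated into the complement; so an orbit is outside for at most
two steps. -/
theorem codes_parabolic {p b a q : ℝ} (hp : 0 ≤ p) (hb : 0 ≤ b) (ha : 0 ≤ a) (hq : 0 ≤ q) :
    Codes parabolicSubst (exchangeWords p b a q) (exchangeWords (p + b + q) b (a + q) q) := by
  refine codes_orbitWords (by decide) (b + q)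
    (fun x => b + q < x ∧ x < b + q + (p + b + a + q)) ?_ ?_ ?_ ?_
  · intro i x hx
    fin_cases i <;>
      simp [parabolicSubst, leftEnd, rightEnd, translation, Follows] at hx ⊢ <;>
      refine ⟨?_, ⟨?_, ?_⟩, ?_, ?_⟩ <;> (try split_ands) <;> linarith
  · intro w t h
    by_contra! hn
    have h0 := h.cases 0
    have h1 := h.cases (0 + 1)
    have h2 := h.cases (0 + 1 + 1)
    have h3 := h.cases (0 + 1 + 1 + 1)
    have n1 := hn (0 + 1)
    have n2 := hn (0 + 1 + 1)
    have n3 := hn (0 + 1 + 1 + 1)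
    grind (splits := 30)
  · intro w t h n hn
    have h0 := h.cases n
    have h1 := h.cases (n + 1)
    have h2 := h.cases (n + 1 + 1)
    have : (w n = 0 ∧ b + q < t n ∧ t n < b + q + p) ∨
        (w n = 1 ∧ w (n + 1) = 0 ∧ b + q + p < t n ∧ t n < b + q + p + b) ∨
        (w n = 2 ∧ b + q + p + b < t n ∧ t n < b + q + p + b + a) ∨
        (w n = 2 ∧ w (n + 1) = 3 ∧ w (n + 1 + 1) = 0 ∧
          b + q + p + b + a < t n ∧ t n < b + q + p + b + a + q) := by
      grind (splits := 30)
    rcases this with h | h | h | h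
    · exact ⟨0, by simp_all [parabolicSubst, window],
        by constructor <;> simp [leftEnd, rightEnd] <;> linarith⟩
    · exact ⟨1, by simp_all [parabolicSubst, window],
        by constructor <;> simp [leftEnd, rightEnd] <;> linarith⟩
    · exact ⟨2, by simp_all [parabolicSubst, window],
        by constructor <;> simp [leftEnd, rightEnd] <;> linarith⟩
    · exact ⟨3, by simp_all [parabolicSubst, window],
        by constructor <;> simp [leftEnd, rightEnd] <;> linarith⟩
  · intro w t h n hn
    -- The longest return word has length three, so going back three steps suffices.
    obtain ⟨m, rfl⟩ : ∃ m, n = m + 1 + 1 + 1 := ⟨n - 3, by ring⟩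
    have h0 := h.cases m
    have h1 := h.cases (m + 1)
    have h2 := h.cases (m + 1 + 1)
    have : (w (m + 1 + 1) = 0 ∧ b + q < t (m + 1 + 1) ∧ t (m + 1 + 1) < b + q + p) ∨
        (w (m + 1) = 1 ∧ w (m + 1 + 1) = 0 ∧
          b + q + p < t (m + 1) ∧ t (m + 1) < b + q + p + b) ∨
        (w (m + 1 + 1) = 2 ∧ b + q + p + b < t (m + 1 + 1) ∧
          t (m + 1 + 1) < b + q + p + b + a) ∨
        (w m = 2 ∧ w (m + 1) = 3 ∧ w (m + 1 + 1) = 0 ∧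
          b + q + p + b + a < t m ∧ t m < b + q + p + b + a + q) := by
      grind (splits := 30)
    rcases this with h | h | h | h
    · exact ⟨0, m + 1 + 1, by simp [parabolicSubst], by simp_all [parabolicSubst, window],
        by constructor <;> simp [leftEnd, rightEnd] <;> linarith⟩
    · exact ⟨1, m + 1, by simp [parabolicSubst]; ring, by simp_all [parabolicSubst, window],
        by constructor <;> simp [leftEnd, rightEnd] <;> linarith⟩
    · exact ⟨2, m + 1 + 1, by simp [parabolicSubst], by simp_all [parabolicSubst, window],
        by constructor <;> simp [leftEnd, rightEnd] <;> linarith⟩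
    · exact ⟨3, m, by simp [parabolicSubst]; ring, by simp_all [parabolicSubst, window],
        by constructor <;> simp [leftEnd, rightEnd] <;> linarith⟩

/-- The substitution for the second renormalization, which is induced on the interval `(b, p + b)`
(the intervals I and II without the image of II). -/
def hyperbolicSubst : Fin 4 → List (Fin 4) := ![[0, 2, 3], [0, 3], [1, 0], [1, 0, 2, 3]]

/-- The four itineraries from a visit to the inducing interval up to the next visit, found by
following the orbit and discarding impossible intervals; `hyperbolic_prev` does the same backwards
in time. -/
theorem hyperbolic_next {p b a q : ℝ} (hp : 0 ≤ p) (hb : 0 ≤ b) (ha : 0 ≤ a) (hq : 0 ≤ q)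
    {w : ℤ → Fin 4} {t : ℤ → ℝ}
    (h : IsOrbit (leftEnd (p + b + a + q) (a + q) (p + q))
      (rightEnd (p + b + a + q) (a + q) (p + q) (p + b + q))
      (translation (p + b + a + q) (a + q) (p + q) (p + b + q)) w t) (n : ℤ)
    (hn : a + q < t n ∧ t n < a + q + (p + b + a + q)) :
    (w n = 0 ∧ w (n + 1) = 2 ∧ w (n + 1 + 1) = 3 ∧ a + q < t n ∧ t n < a + q + p) ∨
    (w n = 0 ∧ w (n + 1) = 3 ∧ a + q + p < t n ∧ t n < a + q + p + b) ∨
    (w n = 1 ∧ w (n + 1) = 0 ∧ a + q + p + b < t n ∧ t n < a + q + p + b + a) ∨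
    (w n = 1 ∧ w (n + 1) = 0 ∧ w (n + 1 + 1) = 2 ∧ w (n + 1 + 1 + 1) = 3 ∧
      a + q + p + b + a < t n ∧ t n < a + q + p + b + a + q) := by
  obtain ⟨hn₁, hn₂⟩ := hn
  rcases h.cases n with ⟨e0, l0, u0, s0⟩ | ⟨e0, l0, u0, s0⟩ | ⟨e0, l0, u0, s0⟩ | ⟨e0, l0, u0, s0⟩
  · rcases h.cases (n + 1) with
      ⟨e1, l1, u1, s1⟩ | ⟨e1, l1, u1, s1⟩ | ⟨e1, l1, u1, s1⟩ | ⟨e1, l1, u1, s1⟩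
    · linarith
    · linarith
    · rcases h.cases (n + 1 + 1) with
        ⟨e2, l2, u2, s2⟩ | ⟨e2, l2, u2, s2⟩ | ⟨e2, l2, u2, s2⟩ | ⟨e2, l2, u2, s2⟩
      any_goals linarith
      exact .inl ⟨e0, e1, e2, by linarith, by linarith⟩
    · exact .inr (.inl ⟨e0, e1, by linarith, by linarith⟩)
  · rcases h.cases (n + 1) with
      ⟨e1, l1, u1, s1⟩ | ⟨e1, l1, u1, s1⟩ | ⟨e1, l1, u1, s1⟩ | ⟨e1, l1, u1, s1⟩
    any_goals linarith
    rcases h.cases (n + 1 + 1) with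
      ⟨e2, l2, u2, s2⟩ | ⟨e2, l2, u2, s2⟩ | ⟨e2, l2, u2, s2⟩ | ⟨e2, l2, u2, s2⟩
    · exact .inr (.inr (.inl ⟨e0, e1, by linarith, by linarith⟩))
    · exact .inr (.inr (.inl ⟨e0, e1, by linarith, by linarith⟩))
    · rcases h.cases (n + 1 + 1 + 1) with
        ⟨e3, l3, u3, s3⟩ | ⟨e3, l3, u3, s3⟩ | ⟨e3, l3, u3, s3⟩ | ⟨e3, l3, u3, s3⟩
      any_goals linarith
      exact .inr (.inr (.inr ⟨e0, e1, e2, e3, by linarith, by linarith⟩))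
    · linarith
  · linarith
  · linarith

theorem hyperbolic_prev {p b a q : ℝ} (hp : 0 ≤ p) (hb : 0 ≤ b) (ha : 0 ≤ a) (hq : 0 ≤ q)
    {w : ℤ → Fin 4} {t : ℤ → ℝ}
    (h : IsOrbit (leftEnd (p + b + a + q) (a + q) (p + q))
      (rightEnd (p + b + a + q) (a + q) (p + q) (p + b + q))
      (translation (p + b + a + q) (a + q) (p + q) (p + b + q)) w t) (m : ℤ)
    (hm : a + q < t (m + 1 + 1 + 1 + 1) ∧ t (m + 1 + 1 + 1 + 1) < a + q + (p + b + a + q)) :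
    (w (m + 1) = 0 ∧ w (m + 1 + 1) = 2 ∧ w (m + 1 + 1 + 1) = 3 ∧
      a + q < t (m + 1) ∧ t (m + 1) < a + q + p) ∨
    (w (m + 1 + 1) = 0 ∧ w (m + 1 + 1 + 1) = 3 ∧
      a + q + p < t (m + 1 + 1) ∧ t (m + 1 + 1) < a + q + p + b) ∨
    (w (m + 1 + 1) = 1 ∧ w (m + 1 + 1 + 1) = 0 ∧
      a + q + p + b < t (m + 1 + 1) ∧ t (m + 1 + 1) < a + q + p + b + a) ∨
    (w m = 1 ∧ w (m + 1) = 0 ∧ w (m + 1 + 1) = 2 ∧ w (m + 1 + 1 + 1) = 3 ∧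
      a + q + p + b + a < t m ∧ t m < a + q + p + b + a + q) := by
  obtain ⟨hm₁, hm₂⟩ := hm
  rcases h.cases (m + 1 + 1 + 1) with
    ⟨e3, l3, u3, s3⟩ | ⟨e3, l3, u3, s3⟩ | ⟨e3, l3, u3, s3⟩ | ⟨e3, l3, u3, s3⟩
  · rcases h.cases (m + 1 + 1) with
      ⟨e2, l2, u2, s2⟩ | ⟨e2, l2, u2, s2⟩ | ⟨e2, l2, u2, s2⟩ | ⟨e2, l2, u2, s2⟩
    any_goals linarith
    exact .inr (.inr (.inl ⟨e2, e3, by linarith, by linarith⟩))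
  · linarith
  · linarith
  · rcases h.cases (m + 1 + 1) with
      ⟨e2, l2, u2, s2⟩ | ⟨e2, l2, u2, s2⟩ | ⟨e2, l2, u2, s2⟩ | ⟨e2, l2, u2, s2⟩
    any_goals linarith
    · exact .inr (.inl ⟨e2, e3, by linarith, by linarith⟩)
    · rcases h.cases (m + 1) with
        ⟨e1, l1, u1, s1⟩ | ⟨e1, l1, u1, s1⟩ | ⟨e1, l1, u1, s1⟩ | ⟨e1, l1, u1, s1⟩
      any_goals linarith
      rcases h.cases m with
        ⟨e0, l0, u0, s0⟩ | ⟨e0, l0, u0, s0⟩ | ⟨e0, l0, u0, s0⟩ | ⟨e0, l0, u0, s0⟩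
      any_goals linarith
      · exact .inr (.inr (.inr ⟨e0, e1, e2, e3, by linarith, by linarith⟩))
      · exact .inl ⟨e1, e2, e3, by linarith, by linarith⟩

theorem codes_hyperbolic {p b a q : ℝ} (hp : 0 ≤ p) (hb : 0 ≤ b) (ha : 0 ≤ a) (hq : 0 ≤ q) :
    Codes hyperbolicSubst (exchangeWords p b a q)
      (exchangeWords (p + b + a + q) (a + q) (p + q) (p + b + q)) := by
  refine codes_orbitWords (by decide) (a + q)
    (fun x => a + q < x ∧ x < a + q + (p + b + a + q)) ?_ ?_ ?_ ?_
  · intro i x hx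
    fin_cases i <;>
      simp [hyperbolicSubst, leftEnd, rightEnd, translation, Follows] at hx ⊢ <;>
      split_ands <;> linarith
  · intro w t h
    by_contra! hn
    have h0 := h.cases 0
    have h1 := h.cases (0 + 1)
    have h2 := h.cases (0 + 1 + 1)
    have h3 := h.cases (0 + 1 + 1 + 1)
    have n1 := hn (0 + 1)
    have n2 := hn (0 + 1 + 1)
    have n3 := hn (0 + 1 + 1 + 1)
    have n4 := hn (0 + 1 + 1 + 1 + 1)
    grind (splits := 30)
  · intro w t h n hn
    have := hyperbolic_next hp hb ha hq h n hn
    rcases this with h | h | h | h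
    · exact ⟨0, by simp_all [hyperbolicSubst, window],
        by constructor <;> simp [leftEnd, rightEnd] <;> linarith⟩
    · exact ⟨1, by simp_all [hyperbolicSubst, window],
        by constructor <;> simp [leftEnd, rightEnd] <;> linarith⟩
    · exact ⟨2, by simp_all [hyperbolicSubst, window],
        by constructor <;> simp [leftEnd, rightEnd] <;> linarith⟩
    · exact ⟨3, by simp_all [hyperbolicSubst, window],
        by constructor <;> simp [leftEnd, rightEnd] <;> linarith⟩
  · intro w t h n hn
    obtain ⟨m, rfl⟩ : ∃ m, n = m + 1 + 1 + 1 + 1 := ⟨n - 4, by ring⟩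
    have := hyperbolic_prev hp hb ha hq h m hn
    rcases this with h | h | h | h
    · exact ⟨0, m + 1, by simp [hyperbolicSubst]; ring, by simp_all [hyperbolicSubst, window],
        by constructor <;> simp [leftEnd, rightEnd] <;> linarith⟩
    · exact ⟨1, m + 1 + 1, by simp [hyperbolicSubst]; ring,
        by simp_all [hyperbolicSubst, window],
        by constructor <;> simp [leftEnd, rightEnd] <;> linarith⟩
    · exact ⟨2, m + 1 + 1, by simp [hyperbolicSubst]; ring,
        by simp_all [hyperbolicSubst, window],
        by constructor <;> simp [leftEnd, rightEnd] <;> linarith⟩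
    · exact ⟨3, m, by simp [hyperbolicSubst]; ring, by simp_all [hyperbolicSubst, window],
        by constructor <;> simp [leftEnd, rightEnd] <;> linarith⟩

/-- The symmetry that reverses the order of the intervals. -/
def flipSubst : Fin 4 → List (Fin 4) := ![[3], [2], [1], [0]]

/-- The order II, IV, I, III is unchanged when it is read backwards and the labels are reversed, so
`x ↦ p + b + a + q - x` conjugates the two exchanges. -/
theorem codes_flip (p b a q : ℝ) :
    Codes flipSubst (exchangeWords p b a q) (exchangeWords q a b p) := by
  have key : ∀ {p b a q : ℝ} {w : ℤ → Fin 4} {t : ℤ → ℝ},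
      IsOrbit (leftEnd p b a) (rightEnd p b a q) (translation p b a q) w t →
      IsOrbit (leftEnd q a b) (rightEnd q a b p) (translation q a b p) (fun n => (w n).rev)
        (fun n => p + b + a + q - t n) := by
    intro p b a q w t h n
    rcases h.cases n with h | h | h | h <;>
      simp [h, leftEnd, rightEnd, translation, Fin.rev] <;> split_ands <;> linarith
  have hflip : ∀ i, flipSubst i = [i.rev] := by decide
  refine ⟨fun w ⟨t, h⟩ => ⟨_, ⟨_, key h⟩, id, fun n => ?_⟩, fun w ⟨t, h⟩ =>
    ⟨_, ⟨_, key h⟩, id, fun n => ?_⟩⟩ <;> simp [hflip, window]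

end DoublePentagon

namespace DoublePentagon

open Real

/-! ## Periods for the directions with coordinates in `ℤ[φ]` -/

theorem orbitWords_scale {S : Type} {lo hi sh lo' hi' sh' : S → ℝ} {c : ℝ} (hc : 0 < c)
    (hlo : ∀ i, c * lo i = lo' i) (hhi : ∀ i, c * hi i = hi' i) (hsh : ∀ i, c * sh i = sh' i) :
    orbitWords lo hi sh = orbitWords lo' hi' sh' := by
  ext w
  constructor
  · rintro ⟨t, h⟩
    refine ⟨fun n => c * t n, fun n => ⟨⟨?_, ?_⟩, ?_⟩⟩
    · rw [← hlo]
      exact mul_lt_mul_of_pos_left (h n).1.1 hc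
    · rw [← hhi]
      exact mul_lt_mul_of_pos_left (h n).1.2 hc
    · beta_reduce
      rw [(h n).2, ← hsh, mul_add]
  · rintro ⟨t, h⟩
    have e : ∀ x, c * (c⁻¹ * x) = x := fun x => by field_simp
    refine ⟨fun n => c⁻¹ * t n, fun n => ⟨⟨?_, ?_⟩, ?_⟩⟩
    · refine lt_of_mul_lt_mul_left ?_ hc.le
      rw [hlo, e]
      exact (h n).1.1
    · refine lt_of_mul_lt_mul_left ?_ hc.le
      rw [hhi, e]
      exact (h n).1.2
    · refine mul_left_cancel₀ hc.ne' ?_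
      beta_reduce
      rw [(h n).2, mul_add, mul_add, mul_add, hsh, e, e]

theorem shift_eq (u : ℝ) : shift u = ![goldenRatio - cut u 1 - (cut u 3 - cut u 2), -cut u 1,
    goldenRatio - cut u 3, cut u 2 - cut u 1 - cut u 3] := by
  have h₀ : (Finset.univ.filter fun j => place j < place 0) = {1, 3} := by decide
  have h₁ : (Finset.univ.filter fun j => place j < place 1) = ∅ := by decide
  have h₂ : (Finset.univ.filter fun j => place j < place 2) = {0, 1, 3} := by decide
  have h₃ : (Finset.univ.filter fun j => place j < place 3) = {1} := by decide
  have k₁ : (Finset.univ.filter fun j : Fin 4 => j < 1) = {0} := by decide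
  have k₂ : (Finset.univ.filter fun j : Fin 4 => j < 2) = {0, 1} := by decide
  have k₃ : (Finset.univ.filter fun j : Fin 4 => j < 3) = {0, 1, 2} := by decide
  have l₀ : cut u 0 = 0 := rfl
  have l₄ : cut u 4 = goldenRatio := rfl
  funext i
  fin_cases i
  · change shift u 0 = _
    simp [shift, h₀, intervalLength, l₄]
    ring
  · change shift u 1 = _
    rw [shift, h₁, k₁]
    simp [intervalLength, l₀]
  · change shift u 2 = _
    simp [shift, h₂, k₂, intervalLength, l₀, l₄]
    ring
  · change shift u 3 = _
    rw [shift, h₃, k₃]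
    simp [intervalLength, l₀]

/-! ### Pairs of elements of `ℤ[φ]` and their strips -/

/-- The pair `(a₀ + a₁ φ, b₀ + b₁ φ)` with natural coefficients. -/
@[ext] structure GoldenPair where
  a₀ : ℕ
  a₁ : ℕ
  b₀ : ℕ
  b₁ : ℕ

namespace GoldenPair

noncomputable section

/-- The first component. -/
def fst (V : GoldenPair) : ℝ := V.a₀ + V.a₁ * goldenRatio

/-- The second component. -/
def snd (V : GoldenPair) : ℝ := V.b₀ + V.b₁ * goldenRatio

theorem fst_nonneg (V : GoldenPair) : 0 ≤ V.fst := by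
  have := goldenRatio_pos
  unfold fst
  positivity

theorem snd_nonneg (V : GoldenPair) : 0 ≤ V.snd := by
  have := goldenRatio_pos
  unfold snd
  positivity

/-- The sum of two pairs. -/
def add (V W : GoldenPair) : GoldenPair := ⟨V.a₀ + W.a₀, V.a₁ + W.a₁, V.b₀ + W.b₀, V.b₁ + W.b₁⟩

/-- Multiplication of a pair by `φ`. -/
def phi (V : GoldenPair) : GoldenPair := ⟨V.a₁, V.a₀ + V.a₁, V.b₁, V.b₀ + V.b₁⟩

/-- `(a, b) ↦ (b, a)`. -/
def swap (V : GoldenPair) : GoldenPair := ⟨V.b₀, V.b₁, V.a₀, V.a₁⟩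

/-- `(a, b) ↦ (a + φ b, b)`. -/
def parabolic (V : GoldenPair) : GoldenPair := ⟨V.a₀ + V.b₁, V.a₁ + V.b₀ + V.b₁, V.b₀, V.b₁⟩

/-- `(a, b) ↦ (φ a + φ b, a + φ b)`. -/
def hyperbolic (V : GoldenPair) : GoldenPair :=
  ⟨V.a₁ + V.b₁, V.a₀ + V.a₁ + V.b₀ + V.b₁, V.a₀ + V.b₁, V.a₁ + V.b₀ + V.b₁⟩

/-- The pair `(1, 0)`. -/
def e₁ : GoldenPair := ⟨1, 0, 0, 0⟩

/-- The pair `(0, 1)`. -/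
def e₂ : GoldenPair := ⟨0, 0, 1, 0⟩

/-- The number of visits to the four intervals along the thin strip. -/
def thin (V : GoldenPair) : Fin 4 → ℕ := ![V.a₁, V.b₀, V.a₀, V.b₁]

/-- The number of visits to the four intervals along the thick strip. -/
def thick (V : GoldenPair) : Fin 4 → ℕ := ![V.a₀ + V.a₁, V.b₁, V.a₁, V.b₀ + V.b₁]

/-- The total number of visits along the thin strip. -/
def short (V : GoldenPair) : ℕ := V.a₀ + V.a₁ + V.b₀ + V.b₁

/-- The total number of visits along the thick strip. -/
def long (V : GoldenPair) : ℕ := V.a₀ + 2 * V.a₁ + V.b₀ + 2 * V.b₁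

/-- The coefficients have no common divisor. -/
def IsPrimitive (V : GoldenPair) : Prop :=
  ∀ d : ℕ, d ∣ V.a₀ → d ∣ V.a₁ → d ∣ V.b₀ → d ∣ V.b₁ → d = 1

/-- The words of the exchange of the four intervals with the lengths `φ a, b, a, φ b`. -/
def words (V : GoldenPair) : Set (ℤ → Fin 4) :=
  exchangeWords (goldenRatio * V.fst) V.snd V.fst (goldenRatio * V.snd)

/-- The orbits of the interval exchange form a thin and a thick strip with the expected numbers of
visits to the four intervals. -/
def IsPeriodic (V : GoldenPair) : Prop := V.IsPrimitive ∧ TwoWords V.words V.thin V.thick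

theorem IsPeriodic.swap {V : GoldenPair} (h : V.IsPeriodic) : V.swap.IsPeriodic := by
  refine ⟨fun d h₁ h₂ h₃ h₄ => h.1 d h₃ h₄ h₁ h₂, ?_⟩
  have := h.2.codes (by decide) (codes_flip _ _ _ _)
  convert this using 1
  · rfl
  all_goals
    funext i
    fin_cases i <;> simp [thin, thick, flipSubst, Fin.sum_univ_four, GoldenPair.swap]

/-- By `φ² = φ + 1`, the lengths in `codes_parabolic` are those of the new pair, and the incidence
matrix of the substitution acts on `thin` and `thick` as the map of pairs does. The map is
invertible over the integers, which preserves primitivity. -/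
theorem IsPeriodic.parabolic {V : GoldenPair} (h : V.IsPeriodic) : V.parabolic.IsPeriodic := by
  have hφ := goldenRatio_pos
  have hs := goldenRatio_sq
  refine ⟨fun d h₁ h₂ h₃ h₄ => ?_, ?_⟩
  · simp only [GoldenPair.parabolic] at h₁ h₂ h₃ h₄
    have h₅ := (Nat.dvd_add_left h₄).1 h₁
    have h₆ := (Nat.dvd_add_left h₃).1 ((Nat.dvd_add_left h₄).1 h₂)
    exact h.1 d h₅ h₆ h₃ h₄
  · have hc := codes_parabolic (mul_nonneg hφ.le V.fst_nonneg) V.snd_nonneg V.fst_nonneg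
      (mul_nonneg hφ.le V.snd_nonneg)
    convert h.2.codes (by decide) hc using 1
    · unfold words
      congr 1 <;> simp only [fst, snd, GoldenPair.parabolic] <;> push_cast <;>
        generalize goldenRatio = g at hs ⊢
      · linear_combination V.b₀ * hs
      · linear_combination -V.b₁ * hs
    all_goals
      funext i
      fin_cases i <;>
        simp [thin, thick, parabolicSubst, Fin.sum_univ_four, GoldenPair.parabolic] <;> ring

theorem IsPeriodic.hyperbolic {V : GoldenPair} (h : V.IsPeriodic) : V.hyperbolic.IsPeriodic := by
  have hφ := goldenRatio_pos
  have hs := goldenRatio_sq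
  refine ⟨fun d h₁ h₂ h₃ h₄ => ?_, ?_⟩
  · simp only [GoldenPair.hyperbolic] at h₁ h₂ h₃ h₄
    have h₅ : d ∣ V.b₀ := by
      refine (Nat.dvd_add_right h₁).1 ?_
      convert h₄ using 1
      ring
    have h₆ : d ∣ V.a₀ := by
      refine (Nat.dvd_add_left h₄).1 ?_
      convert h₂ using 1
      ring
    have h₇ := (Nat.dvd_add_right h₆).1 h₃
    exact h.1 d h₆ ((Nat.dvd_add_left h₇).1 h₁) h₅ h₇
  · have hc := codes_hyperbolic (mul_nonneg hφ.le V.fst_nonneg) V.snd_nonneg V.fst_nonneg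
      (mul_nonneg hφ.le V.snd_nonneg)
    convert h.2.codes (by decide) hc using 1
    · unfold words
      congr 1 <;> simp only [fst, snd, GoldenPair.hyperbolic] <;> push_cast <;>
        generalize goldenRatio = g at hs ⊢
      · linear_combination (V.a₀ + V.b₀) * hs
      · linear_combination -V.b₁ * hs
      · linear_combination (-V.a₁ - V.b₁) * hs
      · linear_combination V.b₀ * hs
    all_goals
      funext i
      fin_cases i <;>
        simp [thin, thick, hyperbolicSubst, Fin.sum_univ_four, GoldenPair.hyperbolic] <;> ring

/-- For the pair `(0, 1)` the intervals I and III are empty and II, IV stay in place, so orbits are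
fixed points and the words are the constants II and IV. -/
theorem isPeriodic_e₂ : e₂.IsPeriodic := by
  have hφ := goldenRatio_pos
  have e : e₂.words = exchangeWords 0 1 0 goldenRatio := by simp [words, fst, snd, e₂]
  refine ⟨fun d _ _ h _ => Nat.dvd_one.1 h, ?_⟩
  rw [e]
  have hconst : ∀ i c, c = (if i = 1 then 1 else 0) → HasCounts (fun _ : ℤ => (i : Fin 4))
      (fun j => if i = j then 1 else 0) := by
    intro i c _
    exact ⟨1, 0, fun _ => rfl, fun j => by simp [window_succ, List.count_cons]⟩
  refine ⟨fun _ => 1, ⟨fun _ => 1 / 2, fun n => ?_⟩, fun _ => 3,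
    ⟨fun _ => 1 + goldenRatio / 2, fun n => ?_⟩, fun w ⟨t, h⟩ => ?_, ?_, ?_⟩
  · norm_num [leftEnd, rightEnd, translation]
  · generalize goldenRatio = g at hφ ⊢
    refine ⟨⟨?_, ?_⟩, ?_⟩ <;> simp [leftEnd, rightEnd, translation] <;> linarith
  · have hstep : ∀ n, t (n + 1) = t n := fun n => by
      rcases h.cases n with h | h | h | h <;> linarith
    have ht : ∀ n, t n = t 0 := by
      intro n
      induction n using Int.induction_on with
      | zero => rfl
      | succ n ih => rw [hstep, ih]
      | pred n ih => rw [← hstep, sub_add_cancel, ih]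
    rcases h.cases 0 with h0 | h0 | h0 | h0
    · linarith
    · refine .inl ⟨0, fun n => ?_⟩
      rcases h.cases n with h | h | h | h
      · linarith
      · exact h.1
      · linarith
      · linarith [ht n]
    · linarith
    · refine .inr ⟨0, fun n => ?_⟩
      rcases h.cases n with h | h | h | h
      · linarith
      · linarith [ht n]
      · linarith
      · exact h.1
  · convert hconst 1 1 rfl using 1
    funext i
    fin_cases i <;> simp [thin, e₂]
  · convert hconst 3 0 rfl using 1
    funext i
    fin_cases i <;> simp [thick, e₂]

theorem isPeriodic_e₁ : e₁.IsPeriodic := isPeriodic_e₂.swap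

/-- The maps that correspond to the passage to the sides of the adjacent ideal pentagon. -/
def move : Fin 4 → GoldenPair → GoldenPair :=
  ![fun V => V.parabolic.swap, fun V => V.hyperbolic.swap, fun V => V.swap.hyperbolic,
    fun V => V.swap.parabolic]

/-- A composition of the maps `move j`. -/
def walk : List (Fin 4) → GoldenPair → GoldenPair
  | [], V => V
  | j :: l, V => walk l (move j V)

theorem IsPeriodic.move {V : GoldenPair} (h : V.IsPeriodic) (j : Fin 4) :
    (move j V).IsPeriodic := by
  fin_cases j
  · exact h.parabolic.swap
  · exact h.hyperbolic.swap
  · exact h.swap.hyperbolic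
  · exact h.swap.parabolic

theorem IsPeriodic.walk {V : GoldenPair} (h : V.IsPeriodic) (l : List (Fin 4)) :
    (walk l V).IsPeriodic := by
  induction l generalizing V with
  | nil => exact h
  | cons j l ih => exact ih (h.move j)

/-- Together with `move_phi`, this is linearity over `φ`; it carries the relations between the
vertices of the base pentagon over to all generations. -/
theorem move_add (j : Fin 4) (V W : GoldenPair) : move j (V.add W) = (move j V).add (move j W) := by
  fin_cases j <;> ext <;> simp [move, add, swap, parabolic, hyperbolic] <;> ring

theorem move_phi (j : Fin 4) (V : GoldenPair) : move j V.phi = (move j V).phi := by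
  fin_cases j <;> ext <;> simp [move, phi, swap, parabolic, hyperbolic] <;> ring

theorem walk_add (l : List (Fin 4)) (V W : GoldenPair) :
    walk l (V.add W) = (walk l V).add (walk l W) := by
  induction l generalizing V W with
  | nil => rfl
  | cons j l ih => simp [walk, move_add, ih]

theorem walk_phi (l : List (Fin 4)) (V : GoldenPair) : walk l V.phi = (walk l V).phi := by
  induction l generalizing V with
  | nil => rfl
  | cons j l ih => simp [walk, move_phi, ih]

theorem short_add (V W : GoldenPair) : (V.add W).short = V.short + W.short := by
  simp [short, add]; ring

theorem long_add (V W : GoldenPair) : (V.add W).long = V.long + W.long := by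
  simp [long, add]; ring

theorem short_phi (V : GoldenPair) : V.phi.short = V.long := by
  simp [short, long, phi]; ring

theorem long_phi (V : GoldenPair) : V.phi.long = V.short + V.long := by
  simp [short, long, phi]; ring

theorem sum_thin (V : GoldenPair) : ∑ i, V.thin i = V.short := by
  simp [short, thin, Fin.sum_univ_four]; ring

theorem sum_thick (V : GoldenPair) : ∑ i, V.thick i = V.long := by
  simp [long, thick, Fin.sum_univ_four]; ring

theorem IsPrimitive.of_dvd_thin {V : GoldenPair} (h : V.IsPrimitive) {d : ℕ}
    (hd : ∀ i, d ∣ V.thin i) : d = 1 := h d (hd 2) (hd 0) (hd 1) (hd 3)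

theorem IsPrimitive.of_dvd_thick {V : GoldenPair} (h : V.IsPrimitive) {d : ℕ}
    (hd : ∀ i, d ∣ V.thick i) : d = 1 :=
  h d ((Nat.dvd_add_left (hd 2)).1 (hd 0)) (hd 2) ((Nat.dvd_add_left (hd 1)).1 (hd 3)) (hd 1)

theorem IsPrimitive.thin_ne_thick {V : GoldenPair} (h : V.IsPrimitive) : V.thin ≠ V.thick := by
  intro e
  have h₀ := congr_fun e 0
  have h₁ := congr_fun e 1
  have h₂ := congr_fun e 2
  have h₃ := congr_fun e 3
  simp only [thin, thick, Matrix.cons_val] at h₀ h₁ h₂ h₃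
  -- Equality of the counts forces all coefficients to vanish, and then `2` divides them.
  have := h 2 (by omega) (by omega) (by omega) (by omega)
  omega

theorem short_le_long (V : GoldenPair) : V.short ≤ V.long := by
  unfold short long
  omega

theorem IsPrimitive.pos {V : GoldenPair} (h : V.IsPrimitive) : 0 < V.fst + V.snd := by
  have hφ := goldenRatio_pos
  by_contra! hn
  have h₁ : V.fst = 0 := le_antisymm (by linarith [V.snd_nonneg]) V.fst_nonneg
  have h₂ : V.snd = 0 := le_antisymm (by linarith [V.fst_nonneg]) V.snd_nonneg
  have key : ∀ m n : ℕ, (m : ℝ) + n * goldenRatio = 0 → m = 0 ∧ n = 0 := by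
    intro m n hmn
    have : (0 : ℝ) ≤ n * goldenRatio := by positivity
    have hm : (m : ℝ) = 0 := by linarith [m.cast_nonneg (α := ℝ)]
    rw [hm, zero_add] at hmn
    have hn : (n : ℝ) = 0 := (mul_eq_zero.1 hmn).resolve_right hφ.ne'
    exact ⟨by exact_mod_cast hm, by exact_mod_cast hn⟩
  obtain ⟨h₃, h₄⟩ := key _ _ h₁
  obtain ⟨h₅, h₆⟩ := key _ _ h₂
  have := h 2 (by simp [h₃]) (by simp [h₄]) (by simp [h₅]) (by simp [h₆])
  omega

/-- The coordinate of the direction for which the interval exchange of the paper is proportional to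
the one given by the pair. -/
def coord (V : GoldenPair) : ℝ :=
  (1 - goldenRatio / 2) * (V.snd - V.fst) / (V.fst + V.snd)

/-- Multiplication by `φ (a + b)` turns the interval lengths into `φa, b, a, φb`, because `φ² (1 -
φ/2) = 1/2`. -/
theorem intervalWords_coord {V : GoldenPair} (hV : 0 < V.fst + V.snd) :
    intervalWords V.coord = V.words := by
  have hφ := goldenRatio_pos
  have hs := goldenRatio_sq
  have h₁ : goldenRatio * (V.fst + V.snd) * V.coord =
      goldenRatio * (1 - goldenRatio / 2) * (V.snd - V.fst) := by
    unfold coord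
    generalize goldenRatio = g at hφ ⊢
    field_simp
  have h₂ : goldenRatio * (V.fst + V.snd) * (V.coord * (goldenRatio + 1)) =
      goldenRatio * (V.snd - V.fst) / 2 := by
    generalize goldenRatio = g at hs h₁ ⊢
    linear_combination (g + 1) * h₁ - g * (V.snd - V.fst) / 2 * hs
  refine orbitWords_scale (mul_pos hφ hV) (lo := fun i => cut V.coord i.castSucc)
    (hi := fun i => cut V.coord i.succ) (sh := shift V.coord) ?_ ?_ ?_
  all_goals
    try rw [shift_eq]
    generalize V.coord = u at h₁ h₂ ⊢
    generalize V.fst = x at h₁ h₂ ⊢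
    generalize V.snd = y at h₁ h₂ ⊢
    intro i
    fin_cases i <;> simp [cut, leftEnd, rightEnd, translation] <;>
      generalize goldenRatio = g at hs h₁ h₂ ⊢
  · linear_combination -h₂
  · linear_combination -h₁ + y * hs
  · linear_combination -h₂ + (x + y) * hs
  · linear_combination -h₂
  · linear_combination -h₁ + y * hs
  · linear_combination -h₂ + (x + y) * hs
  · linear_combination (x + y) * hs
  · linear_combination 2 * h₂ - h₁ + y * hs
  · linear_combination h₂
  · linear_combination h₂
  · linear_combination 2 * h₂ - h₁ - x * hs

end

end GoldenPair

end DoublePentagon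

namespace DoublePentagon

open Real

/-! ## Trajectories in the directions of the principal sector -/

section Plane

/-- The point `(p, q)` lies inside the `k`th side of the regular pentagon, in the affine coordinates
in which its corners are `(g/2, 1), (0, 0), ((g-1)/2, -g), ((g+1)/2, -g), (g, 0)`. -/
def OnSide (g : ℝ) (k : ZMod 5) (p q : ℝ) : Prop :=
  ∃ x y, 0 < x ∧ x < 1 ∧ y = g * x ∧
    ((k = 0 ∧ p = g / 2 - y / 2 ∧ q = 1 - x) ∨ (k = 1 ∧ p = (y - x) / 2 ∧ q = -y) ∨
      (k = 2 ∧ p = (g - 1) / 2 + x ∧ q = -g) ∨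
      (k = 3 ∧ p = (g + 1) / 2 + (y - x) / 2 ∧ q = y - g) ∨ (k = 4 ∧ p = g - y / 2 ∧ q = x))

variable {g u : ℝ}

/-- The five expressions are, up to positive factors, the distances from the lines of the sides.
Strictness is recorded for sides 1 and 3, since the directions at the ends of the sector are
parallel to them. -/
theorem OnSide.heights (hs : g ^ 2 = g + 1) (hg : 1 < g) {k : ZMod 5} {p q : ℝ}
    (h : OnSide g k p q) :
    (0 ≤ p - g / 2 * q ∧ (k = 0 → p - g / 2 * q = 0)) ∧
    ((k = 1 → g * p + (g - 1) / 2 * q = 0) ∧ (k ≠ 1 → 0 < g * p + (g - 1) / 2 * q)) ∧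
    ((k = 2 → q = -g) ∧ -g ≤ q) ∧
    ((k = 3 → g * (g - p) + (g - 1) / 2 * q = 0) ∧
      (k ≠ 3 → 0 < g * (g - p) + (g - 1) / 2 * q)) ∧
    (0 ≤ g - p - g / 2 * q ∧ (k = 4 → g - p - g / 2 * q = 0)) := by
  obtain ⟨x, y, hx, hx1, hy, h⟩ := h
  have hyy : g * y = y + x := by rw [hy]; linear_combination x * hs
  have hxy : x < y := by rw [hy]; nlinarith
  have hyg : y < g := by rw [hy]; nlinarith
  rcases h with ⟨rfl, rfl, rfl⟩ | ⟨rfl, rfl, rfl⟩ | ⟨rfl, rfl, rfl⟩ | ⟨rfl, rfl, rfl⟩ |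
    ⟨rfl, rfl, rfl⟩
  all_goals
    refine ⟨⟨?_, fun hk => ?_⟩, ⟨fun hk => ?_, fun hk => ?_⟩, ⟨fun hk => ?_, ?_⟩,
      ⟨fun hk => ?_, fun hk => ?_⟩, ?_, fun hk => ?_⟩
    all_goals first
      | exact absurd hk (by decide)
      | exact absurd rfl hk
      | linarith

/-- A chord of the pentagon in a direction of the principal sector goes upwards from one of the
three lower sides to one of the two upper sides. -/
theorem OnSide.chord (hs : g ^ 2 = g + 1) (hg : 1 < g) (hu : |u| ≤ 1 - g / 2) {k l : ZMod 5}
    {p q p' q' r : ℝ} (h : OnSide g k p q) (h' : OnSide g l p' q') (hkl : k ≠ l) (hr : 0 < r)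
    (hp : p' = p + u * r) (hq : q' = q + r) : (k = 1 ∨ k = 2 ∨ k = 3) ∧ (l = 0 ∨ l = 4) := by
  obtain ⟨⟨-, h0⟩, ⟨-, h1⟩, ⟨-, h2⟩, ⟨-, h3⟩, -, h4⟩ := h.heights hs hg
  obtain ⟨⟨h0', -⟩, ⟨h1', -⟩, ⟨h2', -⟩, ⟨h3', -⟩, h4', -⟩ := h'.heights hs hg
  obtain ⟨hu1, hu2⟩ := abs_le.1 hu
  subst hp hq
  have a1 : 0 ≤ r * (u + (1 - g / 2)) := mul_nonneg hr.le (by linarith)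
  have a2 : 0 ≤ r * (1 - g / 2 - u) := mul_nonneg hr.le (by linarith)
  have b1 : 0 ≤ g * (r * (u + (1 - g / 2))) := mul_nonneg (by linarith) a1
  have b2 : 0 ≤ g * (r * (1 - g / 2 - u)) := mul_nonneg (by linarith) a2
  have hsr : g ^ 2 * r = g * r + r := by rw [hs]; ring
  have hgr : r < g * r := by nlinarith
  have k0 : k ≠ 0 := fun hk => by have := h0 hk; nlinarith
  have k4 : k ≠ 4 := fun hk => by have := h4 hk; nlinarith
  -- The height over side 1 does not decrease along the chord and is positive at its beginning,
  -- which lies on another side.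
  have l1 : l ≠ 1 := fun hl => by have := h1' hl; have := h1 (hl ▸ hkl); nlinarith
  have l2 : l ≠ 2 := fun hl => by have := h2' hl; linarith
  have l3 : l ≠ 3 := fun hl => by have := h3' hl; have := h3 (hl ▸ hkl); nlinarith
  revert k0 k4 l1 l2 l3
  clear * -
  revert k l
  decide

/-- The position of a point of a side with respect to the direction `(u, 1)`. -/
theorem OnSide.position (hg : 1 < g) (hu : |u| ≤ 1 - g / 2) {k : ZMod 5}
    {p q : ℝ} (h : OnSide g k p q) :
    (k = 0 → 0 < p - u * q ∧ p - u * q < g / 2 - u ∧ 0 < q) ∧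
    (k = 1 → 0 < p - u * q → p - u * q < (g - 1) / 2 + u * g) ∧
    (k = 2 → (g - 1) / 2 + u * g < p - u * q ∧ p - u * q < (g + 1) / 2 + u * g) ∧
    (k = 3 → p - u * q < g → (g + 1) / 2 + u * g < p - u * q) ∧
    (k = 4 → g / 2 - u < p - u * q ∧ p - u * q < g ∧ 0 < q) ∧
    (k = 1 ∨ k = 2 ∨ k = 3 → q < 0) := by
  obtain ⟨x, y, hx, hx1, rfl, h⟩ := h
  obtain ⟨hu1, hu2⟩ := abs_le.1 hu
  rcases h with ⟨rfl, rfl, rfl⟩ | ⟨rfl, rfl, rfl⟩ | ⟨rfl, rfl, rfl⟩ | ⟨rfl, rfl, rfl⟩ |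
    ⟨rfl, rfl, rfl⟩
  · refine ⟨fun _ => ⟨?_, ?_, by linarith⟩, (absurd · (by decide)), (absurd · (by decide)),
      (absurd · (by decide)), (absurd · (by decide)), (absurd · (by decide))⟩
    · have : 0 < (g / 2 - u) * (1 - x) := mul_pos (by linarith) (by linarith)
      linarith
    · have : 0 < (g / 2 - u) * x := mul_pos (by linarith) (by linarith)
      linarith
  · refine ⟨(absurd · (by decide)), fun _ h => ?_, (absurd · (by decide)), (absurd · (by decide)),
      (absurd · (by decide)), fun _ => by nlinarith⟩
    -- Side 1 projects along the direction onto an interval of this length, which is zero at one end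
    -- of the sector; positivity of the position excludes that case.
    have e : (g * x - x) / 2 - u * -(g * x) = x * ((g - 1) / 2 + u * g) := by ring
    rw [e] at h ⊢
    have := pos_of_mul_pos_right h hx.le
    nlinarith
  · exact ⟨(absurd · (by decide)), (absurd · (by decide)), fun _ => ⟨by linarith, by linarith⟩,
      (absurd · (by decide)), (absurd · (by decide)),
      fun _ => by linarith⟩
  · refine ⟨(absurd · (by decide)), (absurd · (by decide)), (absurd · (by decide)), fun _ h => ?_,
      (absurd · (by decide)), fun _ => by nlinarith⟩
    have e : (g + 1) / 2 + (g * x - x) / 2 - u * (g * x - g) =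
        g - (1 - x) * ((g - 1) / 2 - u * g) := by ring
    rw [e] at h ⊢
    have h₁ : 0 < (1 - x) * ((g - 1) / 2 - u * g) := by linarith
    have := pos_of_mul_pos_right h₁ (by linarith)
    nlinarith
  · refine ⟨(absurd · (by decide)), (absurd · (by decide)), (absurd · (by decide)),
      (absurd · (by decide)), fun _ => ⟨?_, ?_, hx⟩, (absurd · (by decide))⟩
    · have : 0 < (g / 2 + u) * (1 - q) := mul_pos (by linarith) (by linarith)
      linarith
    · have : 0 < (g / 2 + u) * q := mul_pos (by linarith) (by linarith)
      linarith

end Plane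

/-! ### Trigonometry of the pentagon and affine coordinates -/

noncomputable section

theorem sin_pi_div_five_pos : 0 < sin (π / 5) :=
  sin_pos_of_pos_of_lt_pi (by positivity) (by linarith [pi_pos])

theorem cos_pi_div_five_eq : cos (π / 5) = goldenRatio / 2 := by
  rw [cos_pi_div_five, goldenRatio]
  ring

theorem sin_sq_pi_div_five : sin (π / 5) ^ 2 = (3 - goldenRatio) / 4 := by
  have h₁ := sin_sq (π / 5)
  have h₂ := goldenRatio_sq
  rw [cos_pi_div_five_eq] at h₁
  generalize goldenRatio = g at *
  linear_combination h₁ - h₂ / 4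

/-- The fifth root of unity `exp (2πi / 5)`. -/
def zeta : ℂ := Complex.exp (2 * Real.pi * Complex.I / 5)

theorem corner_eq_zeta_pow (k : ZMod 5) : corner k = Complex.I * zeta ^ k.val := by
  rw [corner, zeta, ← Complex.exp_nat_mul]
  congr 2
  ring

theorem zeta_eq : zeta = ⟨(goldenRatio - 1) / 2, goldenRatio * sin (π / 5)⟩ := by
  have e : (2 * Real.pi * Complex.I / 5 : ℂ) = ((2 * (π / 5) : ℝ) : ℂ) * Complex.I := by
    push_cast
    ring
  have h₂ := goldenRatio_sq
  rw [zeta, e]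
  apply Complex.ext
  · rw [Complex.exp_ofReal_mul_I_re, cos_two_mul, cos_pi_div_five_eq]
    generalize goldenRatio = g at *
    linear_combination h₂ / 2
  · rw [Complex.exp_ofReal_mul_I_im, sin_two_mul, cos_pi_div_five_eq]
    generalize goldenRatio = g at *
    ring

theorem zeta_pow_five : zeta ^ 5 = 1 := by
  rw [zeta, ← Complex.exp_nat_mul, ← Complex.exp_two_pi_mul_I]
  congr 1
  push_cast
  ring

theorem corner_eq (k : ZMod 5) : corner k =
    (![⟨0, 1⟩, ⟨-(goldenRatio * sin (π / 5)), (goldenRatio - 1) / 2⟩,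
      ⟨-sin (π / 5), -(goldenRatio / 2)⟩, ⟨sin (π / 5), -(goldenRatio / 2)⟩,
      ⟨goldenRatio * sin (π / 5), (goldenRatio - 1) / 2⟩] : Fin 5 → ℂ) k := by
  have h₁ := sin_sq_pi_div_five
  have h₂ := goldenRatio_sq
  have hz := zeta_eq
  generalize goldenRatio = g at *
  generalize sin (π / 5) = s at *
  have hI : Complex.I = ⟨0, 1⟩ := rfl
  have m : ∀ a b c d : ℝ, (⟨a, b⟩ * ⟨c, d⟩ : ℂ) = ⟨a * c - b * d, a * d + b * c⟩ := fun _ _ _ _ =>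
    rfl
  have z2 : zeta ^ 2 = ⟨-g / 2, s⟩ := by
    rw [pow_two, hz, m]
    congr 1
    · linear_combination (-g ^ 2) * h₁ + (g / 4 - 1 / 4) * h₂
    · linear_combination s * h₂
  have z3 : zeta ^ 3 = ⟨-g / 2, -s⟩ := by
    rw [pow_succ, z2, hz, m]
    congr 1
    · linear_combination (-g) * h₁
    · linear_combination (-s / 2) * h₂
  have z4 : zeta ^ 4 = ⟨(g - 1) / 2, -(g * s)⟩ := by
    rw [pow_succ, z3, hz, m]
    congr 1
    · linear_combination (g) * h₁ - (1 / 2) * h₂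
    · linear_combination (-s / 2) * h₂
  rw [corner_eq_zeta_pow]
  fin_cases k
  · change Complex.I * zeta ^ 0 = ⟨0, 1⟩
    rw [pow_zero, mul_one, hI]
  · change Complex.I * zeta ^ 1 = ⟨-(g * s), (g - 1) / 2⟩
    rw [pow_one, hz, hI, m]
    congr 1 <;> ring
  · change Complex.I * zeta ^ 2 = ⟨-s, -(g / 2)⟩
    rw [z2, hI, m]
    congr 1 <;> ring
  · change Complex.I * zeta ^ 3 = ⟨s, -(g / 2)⟩
    rw [z3, hI, m]
    congr 1 <;> ring
  · change Complex.I * zeta ^ 4 = ⟨g * s, (g - 1) / 2⟩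
    rw [z4, hI, m]
    congr 1 <;> ring

/-- The horizontal affine coordinate: the horizontal diagonal of `P` goes from `0` to `φ`. -/
def px (z : ℂ) : ℝ := z.re / (2 * sin (π / 5)) + goldenRatio / 2

/-- The vertical affine coordinate: it is `0` at the horizontal diagonal of `P` and `1` at the
apex. -/
def py (z : ℂ) : ℝ := (2 * z.im - (goldenRatio - 1)) / (3 - goldenRatio)

theorem three_sub_goldenRatio_pos : 0 < 3 - goldenRatio := by linarith [goldenRatio_lt_two]

theorem px_corner (k : ZMod 5) : px (corner k) =
    (![goldenRatio / 2, 0, (goldenRatio - 1) / 2, (goldenRatio + 1) / 2, goldenRatio] :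
      Fin 5 → ℝ) k := by
  have hs := sin_pi_div_five_pos
  rw [px, corner_eq]
  generalize goldenRatio = g at *
  generalize sin (π / 5) = s at *
  fin_cases k
  · change 0 / (2 * s) + g / 2 = g / 2
    simp
  · change -(g * s) / (2 * s) + g / 2 = 0
    field_simp; ring
  · change -s / (2 * s) + g / 2 = (g - 1) / 2
    field_simp; ring
  · change s / (2 * s) + g / 2 = (g + 1) / 2
    field_simp; ring
  · change (g * s) / (2 * s) + g / 2 = g
    field_simp; ring

theorem py_corner (k : ZMod 5) : py (corner k) =
    (![1, 0, -goldenRatio, -goldenRatio, 0] : Fin 5 → ℝ) k := by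
  have hs := three_sub_goldenRatio_pos
  have h₂ := goldenRatio_sq
  rw [py, corner_eq]
  generalize goldenRatio = g at *
  fin_cases k
  · change (2 * 1 - (g - 1)) / (3 - g) = 1
    rw [div_eq_iff hs.ne']; ring
  · change (2 * ((g - 1) / 2) - (g - 1)) / (3 - g) = 0
    rw [div_eq_iff hs.ne']; ring
  · change (2 * -(g / 2) - (g - 1)) / (3 - g) = -g
    rw [div_eq_iff hs.ne']; linear_combination -h₂
  · change (2 * -(g / 2) - (g - 1)) / (3 - g) = -g
    rw [div_eq_iff hs.ne']; linear_combination -h₂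
  · change (2 * ((g - 1) / 2) - (g - 1)) / (3 - g) = 0
    rw [div_eq_iff hs.ne']; ring

theorem px_combo {x y : ℝ} (h : x + y = 1) (a b : ℂ) :
    px (x • a + y • b) = x * px a + y * px b := by
  simp only [px, Complex.add_re, Complex.real_smul, Complex.re_ofReal_mul]
  linear_combination -(goldenRatio / 2) * h

theorem py_combo {x y : ℝ} (h : x + y = 1) (a b : ℂ) :
    py (x • a + y • b) = x * py a + y * py b := by
  simp only [py, Complex.add_im, Complex.real_smul, Complex.im_ofReal_mul]
  linear_combination (goldenRatio - 1) / (3 - goldenRatio) * h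

theorem px_reflect (a b z : ℂ) : px (a + b - z) = px a + px b - px z := by
  simp only [px, Complex.add_re, Complex.sub_re]
  ring

theorem py_reflect (a b z : ℂ) : py (a + b - z) = py a + py b - py z := by
  simp only [py, Complex.add_im, Complex.sub_im]
  ring

theorem onSide_of_mem {k : ZMod 5} {z : ℂ}
    (h : z ∈ openSegment ℝ (corner k) (corner (k + 1))) : OnSide goldenRatio k (px z) (py z) := by
  obtain ⟨x, y, hx, hy, hxy, rfl⟩ := h
  rw [px_combo hxy, py_combo hxy, px_corner, px_corner, py_corner, py_corner]
  have hx' : x = 1 - y := by linarith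
  refine ⟨y, _, hy, by linarith, rfl, ?_⟩
  generalize goldenRatio = g
  subst hx'
  fin_cases k
  · refine .inl ⟨rfl, ?_, ?_⟩
    · change (1 - y) * (g / 2) + y * 0 = _
      ring
    · change (1 - y) * 1 + y * 0 = _
      ring
  · refine .inr (.inl ⟨rfl, ?_, ?_⟩)
    · change (1 - y) * 0 + y * ((g - 1) / 2) = _
      ring
    · change (1 - y) * 0 + y * -g = _
      ring
  · refine .inr (.inr (.inl ⟨rfl, ?_, ?_⟩))
    · change (1 - y) * ((g - 1) / 2) + y * ((g + 1) / 2) = _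
      ring
    · change (1 - y) * -g + y * -g = _
      ring
  · refine .inr (.inr (.inr (.inl ⟨rfl, ?_, ?_⟩)))
    · change (1 - y) * ((g + 1) / 2) + y * g = _
      ring
    · change (1 - y) * -g + y * 0 = _
      ring
  · refine .inr (.inr (.inr (.inr ⟨rfl, ?_, ?_⟩)))
    · change (1 - y) * g + y * (g / 2) = _
      ring
    · change (1 - y) * 0 + y * 1 = _
      ring

theorem reflect_mem_side {a b z : ℂ} (h : z ∈ openSegment ℝ a b) :
    a + b - z ∈ openSegment ℝ a b := by
  obtain ⟨x, y, hx, hy, hxy, rfl⟩ := h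
  refine ⟨y, x, hy, hx, by linarith, ?_⟩
  have : y = 1 - x := by linarith
  subst this
  simp only [Complex.real_smul]
  push_cast
  ring

end

end DoublePentagon

namespace DoublePentagon

open Real

/-! ## The relation of the trajectories to the interval exchange -/

noncomputable section

/-- The position of the intersection of the line through `z` in the direction `u` with the
horizontal diagonal of `P`. -/
def position (u : ℝ) (z : ℂ) : ℝ := px z - u * py z

theorem position_combo (u : ℝ) {x y : ℝ} (h : x + y = 1) (a b : ℂ) :
    position u (x • a + y • b) = x * position u a + y * position u b := by
  rw [position, px_combo h, py_combo h, position, position]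
  ring

theorem position_reflect (u : ℝ) (a b z : ℂ) :
    position u (a + b - z) = position u a + position u b - position u z := by
  rw [position, px_reflect, py_reflect, position, position, position]
  ring

theorem position_corner (u : ℝ) (k : ZMod 5) : position u (corner k) =
    (![goldenRatio / 2 - u, 0, (goldenRatio - 1) / 2 + u * goldenRatio,
      (goldenRatio + 1) / 2 + u * goldenRatio, goldenRatio] : Fin 5 → ℝ) k := by
  rw [position, px_corner, py_corner]
  generalize goldenRatio = g
  fin_cases k
  · change g / 2 - u * 1 = g / 2 - u
    ring
  · change 0 - u * 0 = (0 : ℝ)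
    ring
  · change (g - 1) / 2 - u * -g = (g - 1) / 2 + u * g
    ring
  · change (g + 1) / 2 - u * -g = (g + 1) / 2 + u * g
    ring
  · change g - u * 0 = g
    ring

theorem exists_mem_openSegment_position {u t : ℝ} {a b : ℂ} (ha : position u a < t)
    (hb : t < position u b) : ∃ z ∈ openSegment ℝ a b, position u z = t := by
  have h : 0 < position u b - position u a := by linarith
  refine ⟨_, ⟨(position u b - t) / (position u b - position u a),
    (t - position u a) / (position u b - position u a), div_pos (by linarith) h,
    div_pos (by linarith) h, by field_simp; ring, rfl⟩, ?_⟩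
  rw [position_combo _ (by field_simp; ring)]
  field_simp
  ring

theorem direction_coe (u : ℝ) : direction (u : OnePoint ℝ) = ⟨u, sin (π / 5)⟩ := by
  change (u : ℂ) + ((sin (π / 5) : ℝ) : ℂ) * Complex.I = _
  generalize sin (π / 5) = s
  apply Complex.ext <;> simp

/-- Points with equal positions differ by a multiple of the direction. -/
theorem sub_eq_of_position_eq {u : ℝ} {z z' : ℂ} (h : position u z = position u z') :
    z' - z = ((2 * sin (π / 5) * (py z' - py z) : ℝ) : ℂ) * direction (u : OnePoint ℝ) := by
  have hs := sin_pi_div_five_pos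
  have hs2 := sin_sq_pi_div_five
  have h3 := three_sub_goldenRatio_pos
  have hx : z'.re - z.re = 2 * sin (π / 5) * (px z' - px z) := by
    unfold px
    field_simp
    ring
  have hy : z'.im - z.im = 2 * sin (π / 5) * sin (π / 5) * (py z' - py z) := by
    -- By this identity, the scales of `px` and `py` make the direction with coordinate `u`
    -- proportional to `(u, 1)`.
    have : 2 * sin (π / 5) * sin (π / 5) = (3 - goldenRatio) / 2 := by linarith
    rw [this]
    unfold py
    generalize goldenRatio = g at *
    field_simp
    ring
  have hp : px z' - px z = u * (py z' - py z) := by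
    unfold position at h
    linarith
  rw [direction_coe]
  apply Complex.ext
  · rw [Complex.re_ofReal_mul, Complex.sub_re, hx, hp]
    ring
  · rw [Complex.im_ofReal_mul, Complex.sub_im, hy]
    ring

theorem px_py_of_sub_eq {u r : ℝ} {z z' : ℂ} (h : z' - z = r * direction (u : OnePoint ℝ)) :
    px z' = px z + u * (r / (2 * sin (π / 5))) ∧ py z' = py z + r / (2 * sin (π / 5)) := by
  have hs := sin_pi_div_five_pos
  have hs2 := sin_sq_pi_div_five
  have h3 := three_sub_goldenRatio_pos
  rw [direction_coe] at h
  have hre := congr_arg Complex.re h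
  have him := congr_arg Complex.im h
  rw [Complex.re_ofReal_mul, Complex.sub_re] at hre
  rw [Complex.im_ofReal_mul, Complex.sub_im] at him
  constructor
  · rw [px, px, show z'.re = z.re + r * u by linarith]
    ring
  · rw [py, py, show z'.im = z.im + r * sin (π / 5) by linarith,
      show 3 - goldenRatio = 4 * sin (π / 5) ^ 2 by linarith]
    field_simp
    ring

/-- A chord of `P` in the direction `u` of the principal sector. -/
theorem chord_of_sub_eq {u r : ℝ} (hu : |u| ≤ 1 - goldenRatio / 2) {k l : ZMod 5} {z z' : ℂ}
    (hz : z ∈ openSegment ℝ (corner k) (corner (k + 1)))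
    (hz' : z' ∈ openSegment ℝ (corner l) (corner (l + 1))) (hkl : k ≠ l) (hr : 0 < r)
    (h : z' - z = r * direction (u : OnePoint ℝ)) :
    (k = 1 ∨ k = 2 ∨ k = 3) ∧ (l = 0 ∨ l = 4) ∧ position u z = position u z' := by
  obtain ⟨h₁, h₂⟩ := px_py_of_sub_eq h
  have hs := sin_pi_div_five_pos
  obtain ⟨h₃, h₄⟩ := (onSide_of_mem hz).chord goldenRatio_sq one_lt_goldenRatio hu
    (onSide_of_mem hz') hkl (r := r / (2 * sin (π / 5))) (by positivity) h₁ h₂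
  refine ⟨h₃, h₄, ?_⟩
  rw [position, position, h₁, h₂]
  ring

/-- The pairs of sides crossed between two visits to the horizontal diagonal of `P`. -/
def sidesSubst : Fin 4 → List (ZMod 5) := ![[0, 2], [0, 1], [4, 3], [4, 2]]

/-- The side crossed by the trajectory after the visit to an interval of the diagonal of `P`. -/
def upperSide : Fin 4 → ZMod 5 := ![0, 0, 4, 4]

/-- The side crossed by the trajectory before the return to the diagonal of `P`. -/
def lowerSide : Fin 4 → ZMod 5 := ![2, 1, 3, 2]

theorem sidesSubst_eq (i : Fin 4) : sidesSubst i = [upperSide i, lowerSide i] := by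
  revert i
  decide

theorem position_glue (u : ℝ) (k : ZMod 5) (z : ℂ) :
    position u (glue k - z) = position u (corner k) + position u (corner (k + 1)) -
      position u z := position_reflect _ _ _ _

theorem glue_sub_mem {k : ZMod 5} {z : ℂ}
    (hz : z ∈ openSegment ℝ (corner k) (corner (k + 1))) :
    glue k - z ∈ openSegment ℝ (corner k) (corner (k + 1)) := reflect_mem_side hz

/-- The interval visited between two crossings of sides. -/
theorem exists_interval {u : ℝ} (hu : |u| ≤ 1 - goldenRatio / 2) {k l : ZMod 5} {z z' : ℂ}
    (hk : k = 0 ∨ k = 4) (hl : l = 1 ∨ l = 2 ∨ l = 3)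
    (hz : z ∈ openSegment ℝ (corner k) (corner (k + 1)))
    (hz' : z' ∈ openSegment ℝ (corner l) (corner (l + 1)))
    (h : position u (glue k - z) = position u (glue l - z'))
    (h0 : 0 < position u z') (h1 : position u z' < goldenRatio) :
    ∃ i, k = upperSide i ∧ l = lowerSide i ∧
      position u z ∈ Set.Ioo (cut u i.castSucc) (cut u i.succ) ∧
      position u z' = position u z + shift u i := by
  have hg := one_lt_goldenRatio
  have hs := goldenRatio_sq
  have e := (onSide_of_mem hz).position hg hu
  have e' := (onSide_of_mem hz').position hg hu
  rw [← position] at e e'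
  obtain ⟨hu1, hu2⟩ := abs_le.1 hu
  -- This is `|u| φ² ≤ 1/2`, that is, the bound of the sector multiplied by `φ²`.
  have hU : u * goldenRatio + u ≤ 1 / 2 ∧ -(1 / 2) ≤ u * goldenRatio + u := by
    generalize goldenRatio = g at *
    constructor <;> nlinarith
  rw [position_glue, position_glue] at h
  simp only [position_corner] at h
  rw [shift_eq]
  generalize position u z = t at *
  generalize position u z' = t' at *
  rcases hk with rfl | rfl
  · replace e := e.1 rfl
    rcases hl with rfl | rfl | rfl
    · refine ⟨1, rfl, rfl, ?_⟩
      change goldenRatio / 2 - u + 0 - t = 0 + ((goldenRatio - 1) / 2 + u * goldenRatio) - t' at h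
      simp [cut]
      generalize goldenRatio = g at *
      refine ⟨⟨?_, ?_⟩, ?_⟩ <;> linarith
    · refine ⟨0, rfl, rfl, ?_⟩
      have e'' := e'.2.2.1 rfl
      change goldenRatio / 2 - u + 0 - t = (goldenRatio - 1) / 2 + u * goldenRatio +
        ((goldenRatio + 1) / 2 + u * goldenRatio) - t' at h
      simp [cut]
      generalize goldenRatio = g at *
      refine ⟨⟨?_, ?_⟩, ?_⟩ <;> linarith
    -- From side 0 to side 3 the position would grow by at least `φ`, so the trajectory would miss
    -- the diagonal; from side 4 to side 1 it would drop by as much.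
    · exfalso
      change goldenRatio / 2 - u + 0 - t = (goldenRatio + 1) / 2 + u * goldenRatio +
        goldenRatio - t' at h
      generalize goldenRatio = g at *
      linarith
  · replace e := e.2.2.2.2.1 rfl
    rcases hl with rfl | rfl | rfl
    · exfalso
      change goldenRatio + (goldenRatio / 2 - u) - t =
        0 + ((goldenRatio - 1) / 2 + u * goldenRatio) - t' at h
      generalize goldenRatio = g at *
      linarith
    · refine ⟨3, rfl, rfl, ?_⟩
      have e'' := e'.2.2.1 rfl
      change goldenRatio + (goldenRatio / 2 - u) - t = (goldenRatio - 1) / 2 + u * goldenRatio +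
        ((goldenRatio + 1) / 2 + u * goldenRatio) - t' at h
      simp [cut]
      generalize goldenRatio = g at *
      refine ⟨⟨?_, ?_⟩, ?_⟩ <;> linarith
    · refine ⟨2, rfl, rfl, ?_⟩
      change goldenRatio + (goldenRatio / 2 - u) - t = (goldenRatio + 1) / 2 + u * goldenRatio +
        goldenRatio - t' at h
      simp [cut]
      generalize goldenRatio = g at *
      refine ⟨⟨?_, ?_⟩, ?_⟩ <;> linarith

/-- The crossing points of the trajectory that starts in an interval of the diagonal of `P`. -/
theorem exists_crossings {u t : ℝ} {i : Fin 4}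
    (ht : t ∈ Set.Ioo (cut u i.castSucc) (cut u i.succ)) (hu : |u| ≤ 1 - goldenRatio / 2) :
    ∃ z ∈ openSegment ℝ (corner (upperSide i)) (corner (upperSide i + 1)),
      ∃ z' ∈ openSegment ℝ (corner (lowerSide i)) (corner (lowerSide i + 1)),
        position u z = t ∧ position u z' = t + shift u i ∧
        position u (glue (lowerSide i) - z') = position u (glue (upperSide i) - z) := by
  obtain ⟨hu1, hu2⟩ := abs_le.1 hu
  have hg := one_lt_goldenRatio
  have hs := goldenRatio_sq
  have hU : u * goldenRatio + u ≤ 1 / 2 ∧ -(1 / 2) ≤ u * goldenRatio + u := by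
    generalize goldenRatio = g at *
    constructor <;> nlinarith
  have hV : u * goldenRatio ≤ (goldenRatio - 1) / 2 ∧
      -((goldenRatio - 1) / 2) ≤ u * goldenRatio := by
    generalize goldenRatio = g at *
    constructor <;> nlinarith
  have hdiff : ∀ z z' : ℂ, position u z = t → position u z' = t + shift u i →
      shift u i = position u (corner (lowerSide i)) + position u (corner (lowerSide i + 1)) -
        (position u (corner (upperSide i)) + position u (corner (upperSide i + 1))) →
      position u (glue (lowerSide i) - z') = position u (glue (upperSide i) - z) := by
    intro z z' hz hz' h
    rw [position_glue, position_glue, hz, hz']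
    linarith
  suffices (position u (corner (upperSide i + 1)) < t ∧ t < position u (corner (upperSide i)) ∨
      position u (corner (upperSide i)) < t ∧ t < position u (corner (upperSide i + 1))) ∧
      (position u (corner (lowerSide i)) < t + shift u i ∧
        t + shift u i < position u (corner (lowerSide i + 1))) ∧
      shift u i = position u (corner (lowerSide i)) + position u (corner (lowerSide i + 1)) -
        (position u (corner (upperSide i)) + position u (corner (upperSide i + 1))) by
    obtain ⟨h₁, h₂, h₃⟩ := this
    have h₁' : ∃ z ∈ openSegment ℝ (corner (upperSide i)) (corner (upperSide i + 1)),
        position u z = t := by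
      rcases h₁ with h₁ | h₁
      · rw [openSegment_symm]
        exact exists_mem_openSegment_position h₁.1 h₁.2
      · exact exists_mem_openSegment_position h₁.1 h₁.2
    obtain ⟨z, hz, hzt⟩ := h₁'
    obtain ⟨z', hz', hzt'⟩ := exists_mem_openSegment_position h₂.1 h₂.2
    exact ⟨z, hz, z', hz', hzt, hzt', hdiff z z' hzt hzt' h₃⟩
  obtain ⟨ht1, ht2⟩ := ht
  rw [shift_eq]
  simp only [position_corner]
  fin_cases i
  · change (0 < t ∧ t < goldenRatio / 2 - u ∨ goldenRatio / 2 - u < t ∧ t < 0) ∧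
      ((goldenRatio - 1) / 2 + u * goldenRatio < t + _ ∧
        t + _ < (goldenRatio + 1) / 2 + u * goldenRatio) ∧
      _ = (goldenRatio - 1) / 2 + u * goldenRatio + ((goldenRatio + 1) / 2 + u * goldenRatio) -
        (goldenRatio / 2 - u + 0)
    simp [cut] at ht1 ht2 ⊢
    generalize goldenRatio = g at *
    refine ⟨.inl ⟨?_, ?_⟩, ⟨?_, ?_⟩, ?_⟩ <;> linarith
  · change (0 < t ∧ t < goldenRatio / 2 - u ∨ goldenRatio / 2 - u < t ∧ t < 0) ∧
      (0 < t + _ ∧ t + _ < (goldenRatio - 1) / 2 + u * goldenRatio) ∧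
      _ = 0 + ((goldenRatio - 1) / 2 + u * goldenRatio) - (goldenRatio / 2 - u + 0)
    simp [cut] at ht1 ht2 ⊢
    generalize goldenRatio = g at *
    refine ⟨.inl ⟨?_, ?_⟩, ⟨?_, ?_⟩, ?_⟩ <;> linarith
  · change (goldenRatio / 2 - u < t ∧ t < goldenRatio ∨
        goldenRatio < t ∧ t < goldenRatio / 2 - u) ∧
      ((goldenRatio + 1) / 2 + u * goldenRatio < t + _ ∧ t + _ < goldenRatio) ∧
      _ = (goldenRatio + 1) / 2 + u * goldenRatio + goldenRatio -
        (goldenRatio + (goldenRatio / 2 - u))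
    simp [cut] at ht1 ht2 ⊢
    generalize goldenRatio = g at *
    refine ⟨.inl ⟨?_, ?_⟩, ⟨?_, ?_⟩, ?_⟩ <;> linarith
  · change (goldenRatio / 2 - u < t ∧ t < goldenRatio ∨
        goldenRatio < t ∧ t < goldenRatio / 2 - u) ∧
      ((goldenRatio - 1) / 2 + u * goldenRatio < t + _ ∧
        t + _ < (goldenRatio + 1) / 2 + u * goldenRatio) ∧
      _ = (goldenRatio - 1) / 2 + u * goldenRatio + ((goldenRatio + 1) / 2 + u * goldenRatio) -
        (goldenRatio + (goldenRatio / 2 - u))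
    simp [cut] at ht1 ht2 ⊢
    generalize goldenRatio = g at *
    refine ⟨.inl ⟨?_, ?_⟩, ⟨?_, ?_⟩, ?_⟩ <;> linarith

/-- In the sector, chords of `P` go from lower to upper sides, and so they cross the diagonal; by
central symmetry, chords of `-P` run from the copies of the upper sides to those of the lower ones.
Even crossings are thus upper sides and odd ones lower sides, and the block of the `n`th interval
starts at `2n`. -/
theorem codes_arabic {u : ℝ} (hu : |u| ≤ 1 - goldenRatio / 2) :
    Codes sidesSubst (intervalWords u) (arabicWords (u : OnePoint ℝ)) := by
  have hs := sin_pi_div_five_pos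
  refine ⟨fun w ⟨t, h⟩ => ?_, fun w ⟨z, h⟩ => ?_⟩
  · choose x hx y hy hxt hyt hxy using fun n => exists_crossings (h n).1 hu
    have hpar : ∀ n : ℤ, n = 2 * (n / 2) ∧ Even n ∨ n = 2 * (n / 2) + 1 ∧ Odd n := by
      intro n
      rcases Int.even_or_odd n with hn | hn
      · exact .inl ⟨by obtain ⟨m, rfl⟩ := hn; omega, hn⟩
      · exact .inr ⟨by obtain ⟨m, rfl⟩ := hn; omega, hn⟩
    set v : ℤ → ZMod 5 := fun n =>
      if Even n then upperSide (w (n / 2)) else lowerSide (w (n / 2)) with hv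
    set p : ℤ → ℂ := fun n => if Even n then x (n / 2) else y (n / 2) with hp
    have v0 : ∀ n, v (2 * n) = upperSide (w n) := fun n => by
      simp [hv]
    have v1 : ∀ n, v (2 * n + 1) = lowerSide (w n) := fun n => by
      have : (2 * n + 1) / 2 = n := by omega
      simp [hv, this]
    have p0 : ∀ n, p (2 * n) = x n := fun n => by
      simp [hp]
    have p1 : ∀ n, p (2 * n + 1) = y n := fun n => by
      have : (2 * n + 1) / 2 = n := by omega
      simp [hp, this]
    have hne : ∀ i j, upperSide i ≠ lowerSide j := by decide
    have hup : ∀ i, upperSide i = 0 ∨ upperSide i = 4 := by decide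
    have hlow : ∀ i, lowerSide i = 1 ∨ lowerSide i = 2 ∨ lowerSide i = 3 := by decide
    have pos : ∀ {i z}, z ∈ openSegment ℝ (corner (upperSide i)) (corner (upperSide i + 1)) →
        0 < py z := by
      intro i z hz
      have := (onSide_of_mem hz).position one_lt_goldenRatio hu
      rcases hup i with hi | hi
      · exact (this.1 hi).2.2
      · exact (this.2.2.2.2.1 hi).2.2
    have neg : ∀ {i z}, z ∈ openSegment ℝ (corner (lowerSide i)) (corner (lowerSide i + 1)) →
        py z < 0 := by
      intro i z hz
      exact ((onSide_of_mem hz).position one_lt_goldenRatio hu).2.2.2.2.2 (hlow i)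
    refine ⟨v, ⟨p, fun n => ?_, fun n => ?_, fun n hn => ?_, fun n hn => ?_⟩,
      fun n => 2 * n, fun n => ⟨by simp [sidesSubst_eq]; ring,
        by simp [sidesSubst_eq, window_succ, v0, v1]⟩⟩
    · rcases hpar n with ⟨e, -⟩ | ⟨e, -⟩
      · rw [e, p0, v0]
        exact hx _
      · rw [e, p1, v1]
        exact hy _
    · rcases hpar n with ⟨e, -⟩ | ⟨e, -⟩
      · rw [e, v0, v1]
        exact (hne _ _).symm
      · rw [e, v1, show 2 * (n / 2) + 1 + 1 = 2 * (n / 2 + 1) by ring, v0]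
        exact hne _ _
    · obtain ⟨m, rfl⟩ := hn.exists_two_nsmul
      simp only [nsmul_eq_mul, Nat.cast_ofNat]
      rw [p0, p1, v0, v1]
      refine ⟨_, ?_, (by ring : _ = (glue (upperSide (w m)) - x m) -
        (glue (lowerSide (w m)) - y m)).trans (sub_eq_of_position_eq (hxy m))⟩
      have h₁ := pos (glue_sub_mem (hx m))
      have h₂ := neg (glue_sub_mem (hy m))
      exact mul_pos (by linarith) (by linarith)
    · obtain ⟨m, rfl⟩ := hn
      rw [show 2 * m + 1 + 1 = 2 * (m + 1) by ring, p0, p1]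
      refine ⟨_, ?_, sub_eq_of_position_eq (by rw [hyt, hxt, (h m).2])⟩
      have h₁ := pos (hx (m + 1))
      have h₂ := neg (hy m)
      exact mul_pos (by linarith) (by linarith)
  · have heven : ∀ n, (w (2 * n + 1) = 1 ∨ w (2 * n + 1) = 2 ∨ w (2 * n + 1) = 3) ∧
        (w (2 * n) = 0 ∨ w (2 * n) = 4) ∧
        position u (glue (w (2 * n)) - z (2 * n)) =
          position u (glue (w (2 * n + 1)) - z (2 * n + 1)) := by
      intro n
      obtain ⟨r, hr, e⟩ := h.inside_neg (2 * n) (even_two_mul n)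
      -- The central symmetry `z ↦ -z` takes the chord of `-P` to a chord of `P` and reverses it,
      -- hence the exchanged order of the end points.
      have := chord_of_sub_eq hu (glue_sub_mem (h.mem_side (2 * n + 1)))
        (glue_sub_mem (h.mem_side (2 * n))) (h.side_ne _) hr (by rw [← e]; ring)
      exact ⟨this.1, this.2.1, this.2.2.symm⟩
    have hodd : ∀ n, (w (2 * (n + 1)) = 0 ∨ w (2 * (n + 1)) = 4) ∧
        position u (z (2 * n + 1)) = position u (z (2 * (n + 1))) := by
      intro n
      have e2 : 2 * n + 1 + 1 = 2 * (n + 1) := by ring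
      obtain ⟨r, hr, e⟩ := h.inside_pos (2 * n + 1) (odd_two_mul_add_one n)
      have hne := h.side_ne (2 * n + 1)
      rw [e2] at e hne
      have := chord_of_sub_eq hu (h.mem_side (2 * n + 1)) (h.mem_side (2 * (n + 1)))
        hne.symm hr e
      exact ⟨this.2.1, this.2.2⟩
    have hrange : ∀ n, 0 < position u (z (2 * n)) ∧ position u (z (2 * n)) < goldenRatio := by
      intro n
      have := (onSide_of_mem (h.mem_side (2 * n))).position one_lt_goldenRatio hu
      obtain ⟨hu1, hu2⟩ := abs_le.1 hu
      have hg := one_lt_goldenRatio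
      have hg2 := goldenRatio_lt_two
      unfold position
      rcases (heven n).2.1 with hw | hw
      · obtain ⟨h₁, h₂, -⟩ := this.1 hw
        exact ⟨h₁, by linarith⟩
      · obtain ⟨h₁, h₂, -⟩ := this.2.2.2.2.1 hw
        exact ⟨by linarith, h₂⟩
    choose i hi₁ hi₂ hi₃ hi₄ using fun n => exists_interval hu (heven n).2.1 (heven n).1
      (h.mem_side (2 * n)) (h.mem_side (2 * n + 1)) (heven n).2.2
      (by rw [(hodd n).2]; exact (hrange _).1) (by rw [(hodd n).2]; exact (hrange _).2)
    refine ⟨i, ⟨fun n => position u (z (2 * n)), fun n => ⟨hi₃ n, ?_⟩⟩, fun n => 2 * n,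
      fun n => ⟨by simp [sidesSubst_eq]; ring,
        by simp [sidesSubst_eq, window_succ, hi₁, hi₂]⟩⟩
    beta_reduce
    rw [← (hodd n).2, hi₄]

end

end DoublePentagon

namespace DoublePentagon

open Real

/-! ## Rotations of the double pentagon -/

/-- Periods are preserved by bijections of sets of words that respect shifts and periods. -/
theorem IsPeriodPair.map {S : Type} {W W' : Set (ℤ → S)} {a A : ℕ} (h : IsPeriodPair W a A)
    (F G : (ℤ → S) → ℤ → S) (hF : ∀ w ∈ W, F w ∈ W') (hG : ∀ w ∈ W', G w ∈ W)
    (hFG : ∀ w, F (G w) = w) (hGF : ∀ w, G (F w) = w)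
    (hFs : ∀ w v, ShiftEquiv w v → ShiftEquiv (F w) (F v))
    (hGs : ∀ w v, ShiftEquiv w v → ShiftEquiv (G w) (G v))
    (hFp : ∀ w (c : ℤ), Function.Periodic (F w) c ↔ Function.Periodic w c) :
    IsPeriodPair W' a A := by
  obtain ⟨hle, w, hw, v, hv, hne, hall, hpw, hpv⟩ := h
  have hp : ∀ w p, HasPeriod w p → HasPeriod (F w) p := by
    intro w p h
    simpa only [HasPeriod, hFp] using h
  refine ⟨hle, F w, hF w hw, F v, hF v hv, fun hs => hne ?_, fun x hx => ?_, hp _ _ hpw,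
    hp _ _ hpv⟩
  · simpa only [hGF] using hGs _ _ hs
  · rcases hall _ (hG x hx) with h | h
    · exact .inl (by simpa only [hFG] using hFs _ _ h)
    · exact .inr (by simpa only [hFG] using hFs _ _ h)

noncomputable section

/-- The words of the trajectories in the direction `d`. -/
def trajectoryWords (d : ℂ) : Set (ℤ → ZMod 5) := {w | ∃ z, IsTrajectory d w z}

theorem IsTrajectory.scale {d : ℂ} {w : ℤ → ZMod 5} {z : ℤ → ℂ} (h : IsTrajectory d w z) {c : ℝ}
    (hc : 0 < c) : IsTrajectory (c * d) w z := by
  refine ⟨h.mem_side, h.side_ne, fun n hn => ?_, fun n hn => ?_⟩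
  · obtain ⟨r, hr, e⟩ := h.inside_neg n hn
    refine ⟨r / c, by positivity, ?_⟩
    rw [e, ← mul_assoc, ← Complex.ofReal_mul, div_mul_cancel₀ _ hc.ne']
  · obtain ⟨r, hr, e⟩ := h.inside_pos n hn
    refine ⟨r / c, by positivity, ?_⟩
    rw [e, ← mul_assoc, ← Complex.ofReal_mul, div_mul_cancel₀ _ hc.ne']

theorem trajectoryWords_scale (d : ℂ) {c : ℝ} (hc : 0 < c) :
    trajectoryWords (c * d) = trajectoryWords d := by
  ext w
  constructor
  · rintro ⟨z, h⟩
    refine ⟨z, ?_⟩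
    have := h.scale (inv_pos.2 hc)
    rwa [← mul_assoc, ← Complex.ofReal_mul, inv_mul_cancel₀ hc.ne', Complex.ofReal_one,
      one_mul] at this
  · rintro ⟨z, h⟩
    exact ⟨z, h.scale hc⟩

/-- Reversal of time. -/
theorem IsTrajectory.reverse {d : ℂ} {w : ℤ → ZMod 5} {z : ℤ → ℂ} (h : IsTrajectory d w z) :
    IsTrajectory (-d) (fun n => w (1 - n)) fun n => z (1 - n) := by
  -- With `1 - n` in place of `-n`, the segment after crossing `n` is the old segment after crossing
  -- `-n`, so its parity, and hence its pentagon, is preserved.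
  refine ⟨fun n => h.mem_side _, fun n => ?_, fun n hn => ?_, fun n hn => ?_⟩
  · have := h.side_ne (1 - (n + 1))
    rw [show 1 - (n + 1) + 1 = 1 - n by ring] at this
    exact this.symm
  · obtain ⟨r, hr, e⟩ := h.inside_neg (1 - (n + 1)) (by simpa using hn)
    rw [show 1 - (n + 1) + 1 = 1 - n by ring] at e
    exact ⟨r, hr, by linear_combination -e⟩
  · obtain ⟨r, hr, e⟩ := h.inside_pos (1 - (n + 1)) (by simpa using hn)
    rw [show 1 - (n + 1) + 1 = 1 - n by ring] at e
    exact ⟨r, hr, by linear_combination -e⟩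

theorem IsPeriodPair.trajectory_neg {d : ℂ} {a A : ℕ}
    (h : IsPeriodPair (trajectoryWords d) a A) : IsPeriodPair (trajectoryWords (-d)) a A := by
  have hs : ∀ w v : ℤ → ZMod 5, ShiftEquiv w v →
      ShiftEquiv (fun n => w (1 - n)) (fun n => v (1 - n)) := by
    rintro w v ⟨m, hm⟩
    exact ⟨-m, fun n => by beta_reduce; rw [hm]; congr 1; ring⟩
  have hp : ∀ (w : ℤ → ZMod 5) (c : ℤ), Function.Periodic w c →
      Function.Periodic (fun n => w (1 - n)) c := by
    intro w c hc n
    beta_reduce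
    rw [← hc (1 - (n + c))]
    congr 1
    ring
  refine h.map (fun w n => w (1 - n)) (fun w n => w (1 - n)) ?_ ?_ ?_ ?_ hs hs
    fun w c => ⟨fun h => ?_, hp w c⟩
  · rintro w ⟨z, hz⟩
    exact ⟨_, hz.reverse⟩
  · rintro w ⟨z, hz⟩
    refine ⟨fun n => z (1 - n), ?_⟩
    simpa only [neg_neg] using hz.reverse
  · intro w
    simp
  · intro w
    simp
  · simpa using hp _ c h

theorem corner_add_one (k : ZMod 5) : corner (k + 1) = zeta * corner k := by
  rw [corner_eq_zeta_pow, corner_eq_zeta_pow]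
  fin_cases k
  · change Complex.I * zeta ^ 1 = zeta * (Complex.I * zeta ^ 0)
    ring
  · change Complex.I * zeta ^ 2 = zeta * (Complex.I * zeta ^ 1)
    ring
  · change Complex.I * zeta ^ 3 = zeta * (Complex.I * zeta ^ 2)
    ring
  · change Complex.I * zeta ^ 4 = zeta * (Complex.I * zeta ^ 3)
    ring
  · change Complex.I * zeta ^ 0 = zeta * (Complex.I * zeta ^ 4)
    linear_combination -Complex.I * zeta_pow_five

theorem corner_add_nat (k : ZMod 5) (m : ℕ) : corner (k + m) = zeta ^ m * corner k := by
  induction m with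
  | zero => simp
  | succ m ih =>
    rw [Nat.cast_succ, ← add_assoc, corner_add_one, ih]
    ring

theorem glue_add_nat (k : ZMod 5) (m : ℕ) : glue (k + m) = zeta ^ m * glue k := by
  rw [glue, glue, show k + m + 1 = k + 1 + m by ring, corner_add_nat, corner_add_nat]
  ring

/-- Rotation of the double pentagon by a multiple of 72°. -/
theorem IsTrajectory.rotate {d : ℂ} {w : ℤ → ZMod 5} {z : ℤ → ℂ} (h : IsTrajectory d w z)
    (m : ℕ) : IsTrajectory (zeta ^ m * d) (fun n => w n + m) fun n => zeta ^ m * z n := by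
  refine ⟨fun n => ?_, fun n => ?_, fun n hn => ?_, fun n hn => ?_⟩
  · obtain ⟨x, y, hx, hy, hxy, e⟩ := h.mem_side n
    refine ⟨x, y, hx, hy, hxy, ?_⟩
    rw [show w n + m + 1 = w n + 1 + m by ring, corner_add_nat, corner_add_nat, ← e]
    simp only [Complex.real_smul]
    ring
  · simpa using h.side_ne n
  · obtain ⟨r, hr, e⟩ := h.inside_neg n hn
    refine ⟨r, hr, ?_⟩
    rw [glue_add_nat, glue_add_nat]
    linear_combination zeta ^ m * e
  · obtain ⟨r, hr, e⟩ := h.inside_pos n hn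
    exact ⟨r, hr, by linear_combination zeta ^ m * e⟩

theorem IsPeriodPair.trajectory_rotate {d : ℂ} {a A : ℕ}
    (h : IsPeriodPair (trajectoryWords d) a A) :
    IsPeriodPair (trajectoryWords (zeta ^ 2 * d)) a A := by
  have hs : ∀ (m : ℕ) (w v : ℤ → ZMod 5), ShiftEquiv w v →
      ShiftEquiv (fun n => w n + m) (fun n => v n + m) := by
    rintro m w v ⟨k, hk⟩
    exact ⟨k, fun n => by beta_reduce; rw [hk]⟩
  have h5 : ∀ x : ZMod 5, x + 2 + 3 = x ∧ x + 3 + 2 = x := by decide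
  refine h.map (fun w n => w n + (2 : ℕ)) (fun w n => w n + (3 : ℕ)) ?_ ?_ ?_ ?_ (hs 2) (hs 3)
    fun w c => ?_
  · rintro w ⟨z, hz⟩
    exact ⟨_, hz.rotate 2⟩
  · rintro w ⟨z, hz⟩
    have := hz.rotate 3
    refine ⟨fun n => zeta ^ 3 * z n, ?_⟩
    rwa [← mul_assoc, ← pow_add, zeta_pow_five, one_mul] at this
  · intro w
    funext n
    exact (h5 _).2
  · intro w
    funext n
    exact (h5 _).1
  · simp [Function.Periodic]

/-- The action of `T` is the rotation of directions by -36°. -/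
theorem direction_T_smul (x : OnePoint ℝ) :
    ∃ c : ℝ, c ≠ 0 ∧ direction (T • x) = c * (zeta ^ 2 * direction x) := by
  have hs := sin_sq_pi_div_five
  have hg := goldenRatio_sq
  have h10 : T 1 0 = -4 := rfl
  have h00 : T 0 0 = 2 * goldenRatio := rfl
  have h01 : T 0 1 = 3 - goldenRatio := rfl
  have h11 : T 1 1 = 2 * goldenRatio := rfl
  -- `zeta ^ 2` is the rotation by 144°, which preserves the gluing and differs from the rotation by
  -- -36° only by a change of sign.
  have z2 : zeta ^ 2 = ⟨-(goldenRatio / 2), sin (π / 5)⟩ := by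
    have := corner_add_nat 0 2
    rw [corner_eq, corner_eq] at this
    change (⟨-sin (π / 5), -(goldenRatio / 2)⟩ : ℂ) = zeta ^ 2 * ⟨0, 1⟩ at this
    have e : zeta ^ 2 = zeta ^ 2 * ⟨0, 1⟩ * -Complex.I := by
      have : (⟨0, 1⟩ : ℂ) = Complex.I := rfl
      rw [this]
      linear_combination zeta ^ 2 * Complex.I_sq
    rw [e, ← this]
    generalize sin (π / 5) = s
    apply Complex.ext <;> simp
  rw [z2]
  cases x with
  | infty =>
    refine ⟨1, one_ne_zero, ?_⟩
    rw [OnePoint.smul_infty_eq_ite, h10, h00, if_neg (by norm_num), direction_coe]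
    change _ = ((1 : ℝ) : ℂ) * (_ * 1)
    rw [Complex.ofReal_one, one_mul, mul_one]
    congr 1
    ring
  | coe k =>
    rw [OnePoint.smul_some_eq_ite, h10, h00, h01, h11, direction_coe k]
    split_ifs with h
    · refine ⟨-1, by norm_num, ?_⟩
      change (1 : ℂ) = _
      have hk : k = goldenRatio / 2 := by linarith
      subst hk
      apply Complex.ext
      · rw [Complex.re_ofReal_mul, Complex.mul_re, Complex.one_re]
        change 1 = -1 * (-(goldenRatio / 2) * (goldenRatio / 2) - sin (π / 5) * sin (π / 5))
        generalize goldenRatio = g at *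
        linarith
      · rw [Complex.im_ofReal_mul, Complex.mul_im, Complex.one_im]
        change 0 = -1 * (-(goldenRatio / 2) * sin (π / 5) + sin (π / 5) * (goldenRatio / 2))
        ring
    · refine ⟨-4 / (-4 * k + 2 * goldenRatio), div_ne_zero (by norm_num) h, ?_⟩
      rw [direction_coe]
      apply Complex.ext
      · rw [Complex.re_ofReal_mul, Complex.mul_re]
        change _ / _ = _ * (-(goldenRatio / 2) * k - sin (π / 5) * sin (π / 5))
        rw [← pow_two, hs]
        generalize goldenRatio = g at *
        field_simp
        ring
      · rw [Complex.im_ofReal_mul, Complex.mul_im]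
        change sin (π / 5) = _ * (-(goldenRatio / 2) * sin (π / 5) + sin (π / 5) * k)
        generalize goldenRatio = g at *
        rw [div_mul_eq_mul_div, eq_div_iff h]
        ring

/-- The rotation by 144° permutes the labels; if the real factor `c` is negative, time reversal
corrects the orientation. -/
theorem ArabicPeriods.T_smul {x : OnePoint ℝ} {a A : ℕ} (h : ArabicPeriods x a A) :
    ArabicPeriods (T • x) a A := by
  obtain ⟨c, hc, e⟩ := direction_T_smul x
  have h' : IsPeriodPair (trajectoryWords (zeta ^ 2 * direction x)) a A :=
    IsPeriodPair.trajectory_rotate h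
  change IsPeriodPair (trajectoryWords (direction (T • x))) a A
  rw [e]
  rcases lt_or_gt_of_ne hc with hc | hc
  · have := h'.trajectory_neg
    rw [← trajectoryWords_scale _ (neg_pos.2 hc)] at this
    simpa using this
  · rwa [trajectoryWords_scale _ hc]

theorem ArabicPeriods.T_pow_smul {x : OnePoint ℝ} {a A : ℕ} (h : ArabicPeriods x a A) (n : ℕ) :
    ArabicPeriods (T ^ n • x) a A := by
  induction n with
  | zero => simpa using h
  | succ n ih =>
    rw [pow_succ', mul_smul]
    exact ih.T_smul

/-! ## Periods for the directions of the principal sector -/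

namespace GoldenPair

theorem abs_coord_le {V : GoldenPair} (hV : 0 < V.fst + V.snd) :
    |V.coord| ≤ 1 - goldenRatio / 2 := by
  have h : 0 < 1 - goldenRatio / 2 := by linarith [goldenRatio_lt_two]
  rw [coord, abs_div, abs_mul, abs_of_pos h, abs_of_pos hV, div_le_iff₀ hV]
  refine mul_le_mul_of_nonneg_left ?_ h.le
  rw [abs_le]
  constructor <;> linarith [V.fst_nonneg, V.snd_nonneg]

theorem coord_mem_sector {V : GoldenPair} (hV : 0 < V.fst + V.snd) :
    (V.coord : OnePoint ℝ) ∈ sector := by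
  refine ⟨V.coord, ?_, rfl⟩
  obtain ⟨h₁, h₂⟩ := abs_le.1 (abs_coord_le hV)
  exact ⟨by linarith, h₂⟩

theorem IsPeriodic.romanPeriods {V : GoldenPair} (h : V.IsPeriodic) :
    RomanPeriods (V.coord : OnePoint ℝ) V.short V.long := by
  refine ⟨coord_mem_sector h.1.pos, V.coord, rfl, ?_⟩
  rw [intervalWords_coord h.1.pos, ← sum_thin, ← sum_thick]
  exact h.2.isPeriodPair (fun _ => h.1.of_dvd_thin) (fun _ => h.1.of_dvd_thick)
    (by rw [sum_thin, sum_thick]; exact V.short_le_long) h.1.thin_ne_thick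

/-- Each interval contributes two sides, which doubles the lengths. The numbers of crossings of
sides 1, 3, 0, 4 determine the visits to II, III, I, IV, so side counts inherit coprimality, and the
doubled period is again the least one. -/
theorem IsPeriodic.arabicPeriods {V : GoldenPair} (h : V.IsPeriodic) :
    ArabicPeriods (V.coord : OnePoint ℝ) (2 * V.short) (2 * V.long) := by
  have h₁ : TwoWords (intervalWords V.coord) V.thin V.thick := by
    rw [intervalWords_coord h.1.pos]
    exact h.2
  have h₂ := h₁.codes (by decide) (codes_arabic (abs_coord_le h.1.pos))
  have hsum : ∀ c : Fin 4 → ℕ, ∑ i, ∑ j, c j * (sidesSubst j).count i = 2 * ∑ j, c j := by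
    intro c
    rw [Finset.sum_comm, Finset.mul_sum]
    refine Finset.sum_congr rfl fun j _ => ?_
    rw [← Finset.mul_sum, sum_count, sidesSubst_eq]
    simp [mul_comm]
  have e₀ : ∀ c : Fin 4 → ℕ, ∑ j, c j * (sidesSubst j).count 0 = c 0 + c 1 := by
    have : ∀ j, (sidesSubst j).count 0 = (![1, 1, 0, 0] : Fin 4 → ℕ) j := by decide
    simp [this, Fin.sum_univ_four]
  have e₁ : ∀ c : Fin 4 → ℕ, ∑ j, c j * (sidesSubst j).count 1 = c 1 := by
    have : ∀ j, (sidesSubst j).count 1 = (![0, 1, 0, 0] : Fin 4 → ℕ) j := by decide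
    simp [this, Fin.sum_univ_four]
  have e₃ : ∀ c : Fin 4 → ℕ, ∑ j, c j * (sidesSubst j).count 3 = c 2 := by
    have : ∀ j, (sidesSubst j).count 3 = (![0, 0, 1, 0] : Fin 4 → ℕ) j := by decide
    simp [this, Fin.sum_univ_four]
  have e₄ : ∀ c : Fin 4 → ℕ, ∑ j, c j * (sidesSubst j).count 4 = c 2 + c 3 := by
    have : ∀ j, (sidesSubst j).count 4 = (![0, 0, 1, 1] : Fin 4 → ℕ) j := by decide
    simp [this, Fin.sum_univ_four]
  have hdvd : ∀ (c : Fin 4 → ℕ) (d : ℕ), (∀ i, d ∣ ∑ j, c j * (sidesSubst j).count i) →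
      ∀ j, d ∣ c j := by
    intro c d hd
    have h₁ : d ∣ c 1 := e₁ c ▸ hd 1
    have h₃ : d ∣ c 2 := e₃ c ▸ hd 3
    have h₀ : d ∣ c 0 := (Nat.dvd_add_left h₁).1 (e₀ c ▸ hd 0)
    have h₄ : d ∣ c 3 := (Nat.dvd_add_right h₃).1 (e₄ c ▸ hd 4)
    intro j
    fin_cases j
    · exact h₀
    · exact h₁
    · exact h₃
    · exact h₄
  have h₃ := h₂.isPeriodPair (fun d hd => h.1.of_dvd_thin (hdvd _ d hd))
    (fun d hd => h.1.of_dvd_thick (hdvd _ d hd)) (by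
      rw [hsum, hsum, sum_thin, sum_thick]
      have := V.short_le_long
      omega)
    (fun he => h.1.thin_ne_thick (by
      have g₀ := congr_fun he 0
      have g₁ := congr_fun he 1
      have g₂ := congr_fun he 3
      have g₃ := congr_fun he 4
      rw [e₀, e₀] at g₀
      rw [e₁, e₁] at g₁
      rw [e₃, e₃] at g₂
      rw [e₄, e₄] at g₃
      funext i
      fin_cases i
      · change V.thin 0 = V.thick 0
        omega
      · exact g₁
      · exact g₂
      · change V.thin 3 = V.thick 3
        omega))
  rwa [hsum, hsum, sum_thin, sum_thick] at h₃

end GoldenPair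

end

end DoublePentagon

namespace DoublePentagon

open Real

/-! ## The tree of ideal pentagons -/

theorem smul_eq_of_proportional {g : GL (Fin 2) ℝ} {p q p' q' c : ℝ} (hq : q ≠ 0) (hq' : q' ≠ 0)
    (hc : c ≠ 0) (h₁ : g 0 0 * p + g 0 1 * q = c * p') (h₂ : g 1 0 * p + g 1 1 * q = c * q') :
    g • ((p / q : ℝ) : OnePoint ℝ) = ((p' / q' : ℝ) : OnePoint ℝ) := by
  have e₁ : g 0 0 * (p / q) + g 0 1 = c * p' / q := by
    rw [← h₁]
    field_simp
  have e₂ : g 1 0 * (p / q) + g 1 1 = c * q' / q := by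
    rw [← h₂]
    field_simp
  rw [OnePoint.smul_some_eq_ite, e₁, e₂, if_neg (by positivity)]
  congr 1
  field_simp

theorem coe_T : (T : Matrix (Fin 2) (Fin 2) ℝ) =
    !![2 * goldenRatio, 3 - goldenRatio; -4, 2 * goldenRatio] := rfl

theorem coe_R : (R : Matrix (Fin 2) (Fin 2) ℝ) = !![0, 1; 4 * goldenRatio ^ 4, 0] := rfl

theorem coe_T_sq : ((T ^ 2 : GL (Fin 2) ℝ) : Matrix (Fin 2) (Fin 2) ℝ) =
    !![8 * goldenRatio - 8, 8 * goldenRatio - 4; -16 * goldenRatio, 8 * goldenRatio - 8] := by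
  have hs := goldenRatio_sq
  rw [Units.val_pow_eq_pow_val, coe_T, pow_two]
  generalize goldenRatio = g at *
  ext i j
  fin_cases i <;> fin_cases j <;> simp <;> grind

theorem coe_T_pow_three : ((T ^ 3 : GL (Fin 2) ℝ) : Matrix (Fin 2) (Fin 2) ℝ) =
    !![32 - 32 * goldenRatio, 32 * goldenRatio - 16; -64 * goldenRatio,
      32 - 32 * goldenRatio] := by
  have hs := goldenRatio_sq
  rw [pow_succ, Units.val_mul, coe_T_sq, coe_T]
  generalize goldenRatio = g at *
  ext i j
  fin_cases i <;> fin_cases j <;> simp <;> grind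

theorem coe_T_pow_four : ((T ^ 4 : GL (Fin 2) ℝ) : Matrix (Fin 2) (Fin 2) ℝ) =
    !![-128 * goldenRatio, 192 - 64 * goldenRatio; -256, -128 * goldenRatio] := by
  have hs := goldenRatio_sq
  rw [pow_succ, Units.val_mul, coe_T_pow_three, coe_T]
  generalize goldenRatio = g at *
  ext i j
  fin_cases i <;> fin_cases j <;> simp <;> grind

theorem coe_T_pow_five : ((T ^ 5 : GL (Fin 2) ℝ) : Matrix (Fin 2) (Fin 2) ℝ) =
    !![-1024, 0; 0, -1024] := by
  have hs := goldenRatio_sq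
  rw [pow_succ, Units.val_mul, coe_T_pow_four, coe_T]
  generalize goldenRatio = g at *
  ext i j
  fin_cases i <;> fin_cases j <;> simp <;> grind

theorem T_pow_five_smul (x : OnePoint ℝ) : T ^ 5 • x = x := by
  cases x with
  | infty =>
    rw [OnePoint.smul_infty_eq_ite, coe_T_pow_five]
    simp
  | coe k =>
    rw [OnePoint.smul_some_eq_ite, coe_T_pow_five]
    simp

theorem T_pow_smul_mod (n : ℕ) (x : OnePoint ℝ) : T ^ n • x = T ^ (n % 5) • x := by
  conv_lhs => rw [← Nat.mod_add_div n 5, pow_add, mul_smul, pow_mul]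
  congr 1
  induction n / 5 with
  | zero => simp
  | succ m ih => rw [pow_succ, mul_smul, T_pow_five_smul, ih]

namespace GoldenPair

theorem fst_swap (V : GoldenPair) : V.swap.fst = V.snd := rfl

theorem snd_swap (V : GoldenPair) : V.swap.snd = V.fst := rfl

theorem fst_parabolic (V : GoldenPair) : V.parabolic.fst = V.fst + goldenRatio * V.snd := by
  have hs := goldenRatio_sq
  simp only [fst, snd, parabolic, Nat.cast_add]
  generalize goldenRatio = g at *
  linear_combination -V.b₁ * hs

theorem snd_parabolic (V : GoldenPair) : V.parabolic.snd = V.snd := rfl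

theorem fst_hyperbolic (V : GoldenPair) :
    V.hyperbolic.fst = goldenRatio * V.fst + goldenRatio * V.snd := by
  have hs := goldenRatio_sq
  simp only [fst, snd, hyperbolic, Nat.cast_add]
  generalize goldenRatio = g at *
  linear_combination (-V.a₁ - V.b₁) * hs

theorem snd_hyperbolic (V : GoldenPair) :
    V.hyperbolic.snd = V.fst + goldenRatio * V.snd := by
  have hs := goldenRatio_sq
  simp only [fst, snd, hyperbolic, Nat.cast_add]
  generalize goldenRatio = g at *
  linear_combination -V.b₁ * hs

theorem move_pos {V : GoldenPair} (hV : 0 < V.fst + V.snd) (j : Fin 4) :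
    0 < (move j V).fst + (move j V).snd := by
  have h₁ := V.fst_nonneg
  have h₂ := V.snd_nonneg
  have hg := one_lt_goldenRatio
  have h₃ : V.fst ≤ goldenRatio * V.fst := le_mul_of_one_le_left h₁ hg.le
  have h₄ : V.snd ≤ goldenRatio * V.snd := le_mul_of_one_le_left h₂ hg.le
  fin_cases j <;>
    simp [move, fst_swap, snd_swap, fst_parabolic, snd_parabolic, fst_hyperbolic,
      snd_hyperbolic] <;> linarith

theorem walk_pos {V : GoldenPair} (hV : 0 < V.fst + V.snd) (l : List (Fin 4)) :
    0 < (walk l V).fst + (walk l V).snd := by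
  induction l generalizing V with
  | nil => exact hV
  | cons j l ih => exact ih (move_pos hV j)

/-- The map `move j` describes the passage from the side of a pentagon that is common with the
pentagon of the previous generation to its `j`th side. -/
theorem R_mul_T_pow_smul_coord {V : GoldenPair} (hV : 0 < V.fst + V.snd) (j : Fin 4) :
    (R * T ^ (j.val + 1)) • (V.coord : OnePoint ℝ) = ((move j V).coord : OnePoint ℝ) := by
  have hs := goldenRatio_sq
  have hg := goldenRatio_pos
  -- The determinants of `T` and `R` are `16` and `-4φ⁴`, while `move j` has determinant `±1`; this
  -- leaves the factor `4 ^ (j + 1) * 2φ²`.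
  refine smul_eq_of_proportional (c := 8 * 4 ^ j.val * (goldenRatio + 1)) hV.ne'
    (move_pos hV j).ne' (by positivity) ?_ ?_
  all_goals
    rw [Units.val_mul, coe_R]
    fin_cases j
    · simp [coe_T, move, fst_swap, snd_swap, fst_parabolic, snd_parabolic]
      generalize goldenRatio = g at *
      grind
    · simp [coe_T_sq, move, fst_swap, snd_swap, fst_hyperbolic, snd_hyperbolic,
        -Units.val_pow_eq_pow_val]
      generalize goldenRatio = g at *
      grind
    · simp [coe_T_pow_three, move, fst_swap, snd_swap, fst_hyperbolic, snd_hyperbolic,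
        -Units.val_pow_eq_pow_val]
      generalize goldenRatio = g at *
      grind
    · simp [coe_T_pow_four, move, fst_swap, snd_swap, fst_parabolic, snd_parabolic,
        -Units.val_pow_eq_pow_val]
      generalize goldenRatio = g at *
      grind

theorem e₁_pos : 0 < e₁.fst + e₁.snd := by simp [e₁, fst, snd]

theorem e₂_pos : 0 < e₂.fst + e₂.snd := by simp [e₂, fst, snd]

theorem coord_e₁ : (e₁.coord : OnePoint ℝ) = baseVertex 4 := by
  change _ = ((goldenRatio / 2 - 1 : ℝ) : OnePoint ℝ)
  congr 1
  simp [coord, e₁, fst, snd]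

theorem coord_e₂ : (e₂.coord : OnePoint ℝ) = baseVertex 0 := by
  change _ = ((1 - goldenRatio / 2 : ℝ) : OnePoint ℝ)
  congr 1
  simp [coord, e₂, fst, snd]

/-- The three new vertices across the base side are images of its ends under moves, so their
periodicity follows from that of `e₁` and `e₂`. -/
theorem e₁_phi_add_e₂ : e₁.phi.add e₂ = move 3 e₁ := rfl

theorem e₁_add_e₂_phi : (e₁.add e₂).phi = move 2 e₁ := rfl

theorem e₁_add_phi_e₂ : e₁.add e₂.phi = move 0 e₂ := rfl

theorem R_smul_baseVertex_three : R • baseVertex 3 = ((e₁.phi.add e₂).coord : OnePoint ℝ) := by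
  have hs := goldenRatio_sq
  have hg := goldenRatio_pos
  have e : baseVertex 3 = ((-(goldenRatio / 2) / 1 : ℝ) : OnePoint ℝ) := by
    rw [div_one]
    rfl
  rw [e]
  refine smul_eq_of_proportional (c := -(2 * goldenRatio ^ 3)) one_ne_zero
    (move_pos e₁_pos 3).ne' (neg_ne_zero.2 (by positivity)) ?_ ?_
  all_goals
    rw [coe_R]
    simp [e₁, e₂, fst, snd, phi, add]
    generalize goldenRatio = g at *
    grind

theorem R_smul_baseVertex_two : R • baseVertex 2 = ((e₁.add e₂).phi.coord : OnePoint ℝ) := by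
  have hg := goldenRatio_pos
  have e : baseVertex 2 = OnePoint.infty := rfl
  rw [e, OnePoint.smul_infty_eq_ite, coe_R, if_neg]
  · simp [coord, fst, snd, phi, add, e₁, e₂]
  · change ¬ 4 * goldenRatio ^ 4 = 0
    positivity

theorem R_smul_baseVertex_one : R • baseVertex 1 = ((e₁.add e₂.phi).coord : OnePoint ℝ) := by
  have hs := goldenRatio_sq
  have hg := goldenRatio_pos
  have e : baseVertex 1 = ((goldenRatio / 2 / 1 : ℝ) : OnePoint ℝ) := by
    rw [div_one]
    rfl
  rw [e]
  refine smul_eq_of_proportional (c := 2 * goldenRatio ^ 3) one_ne_zero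
    (move_pos e₂_pos 0).ne' (by positivity) ?_ ?_
  all_goals
    rw [coe_R]
    simp [e₁, e₂, fst, snd, phi, add]
    generalize goldenRatio = g at *
    grind

end GoldenPair

theorem T_smul_baseVertex (j : Fin 5) : T • baseVertex j = baseVertex (j + 1) := by
  have hs := goldenRatio_sq
  have hg := goldenRatio_pos
  have h1 := one_lt_goldenRatio
  have h2 := goldenRatio_lt_two
  fin_cases j
  · change T • ((1 - goldenRatio / 2 : ℝ) : OnePoint ℝ) = ((goldenRatio / 2 : ℝ) : OnePoint ℝ)
    have := smul_eq_of_proportional (g := T) (p := 1 - goldenRatio / 2) (q := 1)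
      (p' := goldenRatio / 2) (q' := 1) (c := 4 * goldenRatio - 4) one_ne_zero one_ne_zero
      (by linarith) (by simp [coe_T]; generalize goldenRatio = g at *; grind)
      (by simp [coe_T]; generalize goldenRatio = g at *; grind)
    simpa using this
  · change T • ((goldenRatio / 2 : ℝ) : OnePoint ℝ) = OnePoint.infty
    rw [OnePoint.smul_some_eq_ite, coe_T, if_pos]
    simp
    generalize goldenRatio = g at *
    ring
  · change T • OnePoint.infty = ((-(goldenRatio / 2) : ℝ) : OnePoint ℝ)
    rw [OnePoint.smul_infty_eq_ite, coe_T, if_neg (by simp)]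
    congr 1
    simp
    generalize goldenRatio = g at *
    ring
  · change T • ((-(goldenRatio / 2) : ℝ) : OnePoint ℝ) =
      ((goldenRatio / 2 - 1 : ℝ) : OnePoint ℝ)
    have := smul_eq_of_proportional (g := T) (p := -(goldenRatio / 2)) (q := 1)
      (p' := goldenRatio / 2 - 1) (q' := 1) (c := 4 * goldenRatio) one_ne_zero one_ne_zero
      (by positivity) (by simp [coe_T]; generalize goldenRatio = g at *; grind)
      (by simp [coe_T]; generalize goldenRatio = g at *; grind)
    simpa using this
  · change T • ((goldenRatio / 2 - 1 : ℝ) : OnePoint ℝ) =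
      ((1 - goldenRatio / 2 : ℝ) : OnePoint ℝ)
    have := smul_eq_of_proportional (g := T) (p := goldenRatio / 2 - 1) (q := 1)
      (p' := 1 - goldenRatio / 2) (q' := 1) (c := 4) one_ne_zero one_ne_zero
      (by norm_num) (by simp [coe_T]; generalize goldenRatio = g at *; grind)
      (by simp [coe_T]; generalize goldenRatio = g at *; grind)
    simpa using this

theorem T_pow_smul_baseVertex (n : ℕ) (j : Fin 5) :
    T ^ n • baseVertex j = baseVertex (j + Fin.ofNat 5 n) := by
  induction n with
  | zero => simp
  | succ n ih =>
    rw [pow_succ', mul_smul, ih, T_smul_baseVertex, add_assoc]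
    congr 2
    ext
    simp [Fin.val_add]

theorem vertex_eq_left (g : GL (Fin 2) ℝ) (j : Fin 5) :
    vertex g j = (g * T ^ (j.val + 1)) • baseVertex 4 := by
  rw [mul_smul, T_pow_smul_baseVertex, vertex]
  congr 2
  revert j
  decide

theorem vertex_eq_right (g : GL (Fin 2) ℝ) (j : Fin 5) :
    vertex g (j + 1) = (g * T ^ (j.val + 1)) • baseVertex 0 := by
  rw [mul_smul, T_pow_smul_baseVertex, vertex]
  congr 2
  revert j
  decide

theorem vertex_across (g : GL (Fin 2) ℝ) (i j : Fin 5) :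
    vertex (across g j) i = (g * T ^ (j.val + 1)) • R • baseVertex i := by
  rw [vertex, across, mul_smul]

open GoldenPair in
/-- The coordinates of all points near a side of an ideal pentagon. -/
theorem exists_walk {k : ℕ} {g : GL (Fin 2) ℝ} {j : Fin 5} (hg : IsPentagon k g)
    (hj : IsOuterSide k j) : ∃ (n : ℕ) (l : List (Fin 4)), ∀ V : GoldenPair,
      0 < V.fst + V.snd → (g * T ^ (j.val + 1)) • (V.coord : OnePoint ℝ) =
        T ^ n • ((walk l V).coord : OnePoint ℝ) := by
  induction hg generalizing j with
  | zero => exact ⟨j.val + 1, [], fun V _ => by rw [one_mul]; rfl⟩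
  | @succ k g i _ hi ih =>
    obtain ⟨n, l, h⟩ := ih hi
    -- Side 4 leads back to the previous generation; only the other four correspond to moves.
    have hj4 : j ≠ 4 := hj.resolve_left (Nat.succ_ne_zero k)
    obtain ⟨j', rfl⟩ : ∃ j' : Fin 4, j = j'.castSucc :=
      ⟨⟨j.val, by have := j.isLt; have : j.val ≠ 4 := fun h => hj4 (Fin.ext h); omega⟩, rfl⟩
    refine ⟨n, j' :: l, fun V hV => ?_⟩
    rw [across, mul_assoc, mul_smul, Fin.val_castSucc, R_mul_T_pow_smul_coord hV,
      h _ (move_pos hV j')]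
    rfl

/-! ### Rotations and the principal sector -/

/-- The sector is the arc between vertices 4 and 0; its image is the adjacent arc between 0 and 1,
and only vertex 0 is common. The image under `T ^ 2`, between 1 and 2, is disjoint from the sector.
-/
theorem T_smul_mem_sector {x : OnePoint ℝ} (hx : x ∈ sector) (h : T • x ∈ sector) :
    x = baseVertex 4 := by
  have hs := goldenRatio_sq
  have h1 := one_lt_goldenRatio
  obtain ⟨k, ⟨hk₁, hk₂⟩, rfl⟩ := hx
  obtain ⟨m, ⟨-, hm⟩, e⟩ := h
  change _ = ((goldenRatio / 2 - 1 : ℝ) : OnePoint ℝ)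
  congr 1
  rw [OnePoint.smul_some_eq_ite, coe_T] at e
  simp at e
  have hd : 0 < -(4 * k) + 2 * goldenRatio := by linarith
  rw [if_neg hd.ne', OnePoint.coe_eq_coe] at e
  rw [e, div_le_iff₀ hd] at hm
  generalize goldenRatio = g at *
  nlinarith

theorem T_sq_smul_notMem_sector {x : OnePoint ℝ} (hx : x ∈ sector) : T ^ 2 • x ∉ sector := by
  have hs := goldenRatio_sq
  have h1 := one_lt_goldenRatio
  have h2 := goldenRatio_lt_two
  obtain ⟨k, ⟨hk₁, hk₂⟩, rfl⟩ := hx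
  rintro ⟨m, ⟨-, hm⟩, e⟩
  rw [OnePoint.smul_some_eq_ite, coe_T_sq] at e
  simp only [Matrix.of_apply, Matrix.cons_val', Matrix.cons_val_zero, Matrix.cons_val_one,
    Matrix.cons_val_fin_one] at e
  split_ifs at e with hd
  · exact OnePoint.coe_ne_infty _ e
  · rw [OnePoint.coe_eq_coe] at e
    have hd' : 0 < -16 * goldenRatio * k + (8 * goldenRatio - 8) := by
      refine lt_of_le_of_ne ?_ (Ne.symm hd)
      generalize goldenRatio = g at *
      nlinarith
    rw [e, div_le_iff₀ hd'] at hm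
    generalize goldenRatio = g at *
    nlinarith

/-- Distinct points of the principal sector do not remain there after a rotation. -/
theorem mod_five_eq_zero_of_mem_sector {x y : OnePoint ℝ} (hx : x ∈ sector) (hy : y ∈ sector)
    (hxy : x ≠ y) {n : ℕ} (hx' : T ^ n • x ∈ sector) (hy' : T ^ n • y ∈ sector) : n % 5 = 0 := by
  rw [T_pow_smul_mod] at hx' hy'
  have key : ∀ z : OnePoint ℝ, ∀ i j : ℕ, i + j = 5 → T ^ i • T ^ j • z = z := by
    intro z i j h
    rw [← mul_smul, ← pow_add, h, T_pow_five_smul]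
  have hn : n % 5 < 5 := Nat.mod_lt _ (by norm_num)
  generalize n % 5 = r at *
  interval_cases r
  · rfl
  · rw [pow_one] at hx' hy'
    exact (hxy ((T_smul_mem_sector hx hx').trans (T_smul_mem_sector hy hy').symm)).elim
  · exact (T_sq_smul_notMem_sector hx hx').elim
  -- Rotations by three and four steps are inverse to those by two steps and one, so they are
  -- treated from the rotated points.
  · refine (T_sq_smul_notMem_sector hx' ?_).elim
    rwa [key x 2 3 rfl]
  · have h₀ : ∀ z : OnePoint ℝ, T • T ^ 4 • z = z := fun z => by
      simpa only [pow_one] using key z 1 4 rfl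
    have h₁ := T_smul_mem_sector hx' (by rwa [h₀])
    have h₂ := T_smul_mem_sector hy' (by rwa [h₀])
    exact (hxy (MulAction.injective (T ^ 4) (h₁.trans h₂.symm))).elim

theorem RomanPeriods.unique {x : OnePoint ℝ} {a A b B : ℕ} (h : RomanPeriods x a A)
    (h' : RomanPeriods x b B) : a = b ∧ A = B := by
  obtain ⟨-, u, rfl, h⟩ := h
  obtain ⟨-, v, e, h'⟩ := h'
  obtain rfl := OnePoint.coe_injective e
  exact h.unique h'

namespace GoldenPair

theorem vertex_left_eq {g : GL (Fin 2) ℝ} {j : Fin 5} {n : ℕ} {l : List (Fin 4)}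
    (h : ∀ V : GoldenPair, 0 < V.fst + V.snd → (g * T ^ (j.val + 1)) • (V.coord : OnePoint ℝ) =
      T ^ n • ((walk l V).coord : OnePoint ℝ)) :
    vertex g j = T ^ n • ((walk l e₁).coord : OnePoint ℝ) := by
  rw [vertex_eq_left, ← coord_e₁, h _ e₁_pos]

theorem vertex_right_eq {g : GL (Fin 2) ℝ} {j : Fin 5} {n : ℕ} {l : List (Fin 4)}
    (h : ∀ V : GoldenPair, 0 < V.fst + V.snd → (g * T ^ (j.val + 1)) • (V.coord : OnePoint ℝ) =
      T ^ n • ((walk l V).coord : OnePoint ℝ)) :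
    vertex g (j + 1) = T ^ n • ((walk l e₂).coord : OnePoint ℝ) := by
  rw [vertex_eq_right, ← coord_e₂, h _ e₂_pos]

/-- Coordinates of the three additional vertices of the pentagon across a side, in terms of those
of the end points of this side. -/
theorem vertex_across_eq {g : GL (Fin 2) ℝ} {j : Fin 5} {n : ℕ} {l : List (Fin 4)}
    (h : ∀ V : GoldenPair, 0 < V.fst + V.snd → (g * T ^ (j.val + 1)) • (V.coord : OnePoint ℝ) =
      T ^ n • ((walk l V).coord : OnePoint ℝ)) :
    vertex (across g j) 3 = T ^ n • (((walk l e₁).phi.add (walk l e₂)).coord : OnePoint ℝ) ∧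
    vertex (across g j) 2 = T ^ n • (((walk l e₁).add (walk l e₂)).phi.coord : OnePoint ℝ) ∧
    vertex (across g j) 1 = T ^ n • (((walk l e₁).add (walk l e₂).phi).coord : OnePoint ℝ) := by
  refine ⟨?_, ?_, ?_⟩
  · rw [vertex_across, R_smul_baseVertex_three,
      h (e₁.phi.add e₂) (move_pos e₁_pos 3), ← walk_phi, ← walk_add]
  · rw [vertex_across, R_smul_baseVertex_two,
      h (e₁.add e₂).phi (move_pos e₁_pos 2), ← walk_add, ← walk_phi]
  · rw [vertex_across, R_smul_baseVertex_one,
      h (e₁.add e₂.phi) (move_pos e₂_pos 0), ← walk_phi, ← walk_add]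

theorem isPeriodic_walk_phi_add (l : List (Fin 4)) :
    ((walk l e₁).phi.add (walk l e₂)).IsPeriodic := by
  rw [← walk_phi, ← walk_add, e₁_phi_add_e₂]
  exact (isPeriodic_e₁.move 3).walk l

theorem isPeriodic_walk_add_phi (l : List (Fin 4)) :
    ((walk l e₁).add (walk l e₂)).phi.IsPeriodic := by
  rw [← walk_add, ← walk_phi, e₁_add_e₂_phi]
  exact (isPeriodic_e₁.move 2).walk l

theorem isPeriodic_walk_add_walk_phi (l : List (Fin 4)) :
    ((walk l e₁).add (walk l e₂).phi).IsPeriodic := by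
  rw [← walk_phi, ← walk_add, e₁_add_phi_e₂]
  exact (isPeriodic_e₂.move 0).walk l

/-- A notion of periods that is given, up to a factor, by the numbers `short` and `long` satisfies
the recurrence relations. -/
theorem recurrence {Q : OnePoint ℝ → ℕ → ℕ → Prop} {n c : ℕ}
    (hu : ∀ {x a A b B}, Q x a A → Q x b B → a = b ∧ A = B)
    (hQ : ∀ V : GoldenPair, V.IsPeriodic →
      Q (T ^ n • (V.coord : OnePoint ℝ)) (c * V.short) (c * V.long))
    {g : GL (Fin 2) ℝ} {j : Fin 5} {l : List (Fin 4)}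
    (h : ∀ V : GoldenPair, 0 < V.fst + V.snd → (g * T ^ (j.val + 1)) • (V.coord : OnePoint ℝ) =
      T ^ n • ((walk l V).coord : OnePoint ℝ)) :
    (∃ a A, Q (vertex g j) a A) ∧ (∃ b B, Q (vertex g (j + 1)) b B) ∧
      ∀ a A b B : ℕ, Q (vertex g j) a A → Q (vertex g (j + 1)) b B →
        Q (vertex (across g j) 3) (b + A) (a + A + B) ∧
        Q (vertex (across g j) 2) (A + B) (a + b + A + B) ∧
        Q (vertex (across g j) 1) (a + B) (b + A + B) := by
  obtain ⟨z₁, z₂, z₃⟩ := vertex_across_eq h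
  rw [vertex_left_eq h, vertex_right_eq h, z₁, z₂, z₃]
  have hX := hQ _ (isPeriodic_e₁.walk l)
  have hY := hQ _ (isPeriodic_e₂.walk l)
  have h₁ := hQ _ (isPeriodic_walk_phi_add l)
  have h₂ := hQ _ (isPeriodic_walk_add_phi l)
  have h₃ := hQ _ (isPeriodic_walk_add_walk_phi l)
  refine ⟨⟨_, _, hX⟩, ⟨_, _, hY⟩, fun a A b B ha hb => ?_⟩
  obtain ⟨rfl, rfl⟩ := hu ha hX
  obtain ⟨rfl, rfl⟩ := hu hb hY
  -- Expanding `short` and `long` of `φX + Y`, `φ(X + Y)`, `X + φY` gives the three recurrences, up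
  -- to the factor `c`.
  simp only [short_add, long_add, short_phi, long_phi] at h₁ h₂ h₃
  refine ⟨?_, ?_, ?_⟩
  · convert h₁ using 1 <;> ring
  · convert h₂ using 1 <;> ring
  · convert h₃ using 1 <;> ring

end GoldenPair

theorem baseVertex_four_ne_zero : baseVertex 4 ≠ baseVertex 0 := by
  change ((goldenRatio / 2 - 1 : ℝ) : OnePoint ℝ) ≠ ((1 - goldenRatio / 2 : ℝ) : OnePoint ℝ)
  have := goldenRatio_lt_two
  exact fun e => absurd (OnePoint.coe_injective e) (by intro e; linarith)

theorem vertex_ne_vertex_add_one (g : GL (Fin 2) ℝ) (j : Fin 5) :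
    vertex g j ≠ vertex g (j + 1) := by
  rw [vertex_eq_left, vertex_eq_right]
  exact fun e => baseVertex_four_ne_zero (MulAction.injective _ e)

end DoublePentagon

theorem theorem2 :
    -- Arabic periods, for all ideal pentagons
    (∀ (k : ℕ) (g : GL (Fin 2) ℝ) (j : Fin 5),
      DoublePentagon.IsPentagon k g → DoublePentagon.IsOuterSide k j →
      (∃ a A, DoublePentagon.ArabicPeriods (DoublePentagon.vertex g j) a A) ∧
      (∃ b B, DoublePentagon.ArabicPeriods (DoublePentagon.vertex g (j + 1)) b B) ∧
      ∀ a A b B : ℕ,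
        DoublePentagon.ArabicPeriods (DoublePentagon.vertex g j) a A →
        DoublePentagon.ArabicPeriods (DoublePentagon.vertex g (j + 1)) b B →
        DoublePentagon.ArabicPeriods
          (DoublePentagon.vertex (DoublePentagon.across g j) 3) (b + A) (a + A + B) ∧
        DoublePentagon.ArabicPeriods
          (DoublePentagon.vertex (DoublePentagon.across g j) 2) (A + B) (a + b + A + B) ∧
        DoublePentagon.ArabicPeriods
          (DoublePentagon.vertex (DoublePentagon.across g j) 1) (a + B) (b + A + B)) ∧
    -- Roman periods, for the ideal pentagons in the principal sector
    (∀ (k : ℕ) (g : GL (Fin 2) ℝ) (j : Fin 5),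
      DoublePentagon.IsPentagon k g → DoublePentagon.IsOuterSide k j →
      DoublePentagon.vertex g j ∈ DoublePentagon.sector →
      DoublePentagon.vertex g (j + 1) ∈ DoublePentagon.sector →
      (∃ a A, DoublePentagon.RomanPeriods (DoublePentagon.vertex g j) a A) ∧
      (∃ b B, DoublePentagon.RomanPeriods (DoublePentagon.vertex g (j + 1)) b B) ∧
      ∀ a A b B : ℕ,
        DoublePentagon.RomanPeriods (DoublePentagon.vertex g j) a A →
        DoublePentagon.RomanPeriods (DoublePentagon.vertex g (j + 1)) b B →
        DoublePentagon.RomanPeriods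
          (DoublePentagon.vertex (DoublePentagon.across g j) 3) (b + A) (a + A + B) ∧
        DoublePentagon.RomanPeriods
          (DoublePentagon.vertex (DoublePentagon.across g j) 2) (A + B) (a + b + A + B) ∧
        DoublePentagon.RomanPeriods
          (DoublePentagon.vertex (DoublePentagon.across g j) 1) (a + B) (b + A + B)) := by
  open DoublePentagon GoldenPair in
  refine ⟨fun k g j hg hj => ?_, fun k g j hg hj hx hy => ?_⟩
  · obtain ⟨n, l, h⟩ := exists_walk hg hj
    exact recurrence (Q := ArabicPeriods) (fun h h' => IsPeriodPair.unique h h')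
      (fun V hV => hV.arabicPeriods.T_pow_smul n) h
  · obtain ⟨n, l, h⟩ := exists_walk hg hj
    have hne := vertex_ne_vertex_add_one g j
    rw [vertex_left_eq h] at hx hne
    rw [vertex_right_eq h] at hy hne
    -- The side and its unrotated copy both have their ends in the sector; a nontrivial rotation
    -- could keep at most one of two distinct points there.
    have hn : n % 5 = 0 := mod_five_eq_zero_of_mem_sector
      (coord_mem_sector (walk_pos e₁_pos l)) (coord_mem_sector (walk_pos e₂_pos l))
      (fun e => hne (by rw [e])) hx hy
    refine recurrence (Q := RomanPeriods) (c := 1) RomanPeriods.unique (fun V hV => ?_) h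
    rw [T_pow_smul_mod, hn, pow_zero, one_smul, one_mul, one_mul]
    exact hV.romanPeriods
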